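/- Let $C=\begin{pmatrix}1&1\\0&1\end{pmatrix}$ and let $\mathrm{Psh}=\mathbb{R}\ltimes\mathbb{R}^2$ be the Lie group $\mathbb{R}^3=\mathbb{R}\times\mathbb{R}^2$ with product $(t,u)(t',u')=(t+t',\,u+e^{tC}u')$. Let $e_1,e_2,e_3$ be the standard basis of its Lie algebra $\mathfrak{psh}=T_1\mathrm{Psh}$, so that $[e_1,e_2]=e_2$, $[e_1,e_3]=e_2+e_3$, $[e_2,e_3]=0$. A left-invariant Lorentzian metric (signature $(-,+,+)$) on $\mathrm{Psh}$ is given by its quadratic form in the coordinates $(x,y,z)$ of $xe_1+ye_2+ze_3\in\mathfrak{psh}$. It is complete if all its maximal Levi-Civita geodesics are defined on $\mathbb{R}$. The velocity of a geodesic $\gamma$ is the curve $v(t)=D_{\gamma(t)}L_{\gamma(t)^{-1}}\dot\gamma(t)$ in $\mathfrak{psh}$. Two metrics $g,h$ are equivalent up to automorphism and scaling if $\varphi^*g=c\,h$ for some Lie group automorphism $\varphi$ of $\mathrm{Psh}$ and some $c\in\mathbb{R}^*$. **Theorem 1.** 1. For every $s>0$ the left-invariant Lorentzian metric $\mathcal{Q}_{2,s}$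 given by $x^2-y^2+sz^2$ is complete, and each of its geodesics has bounded velocity. For distinct values of $s>0$ these metrics are not equivalent up to automorphism and scaling. A left-invariant Lorentzian metric on $\mathrm{Psh}$ is complete with all geodesics of bounded velocity if and only if it is equivalent, up to automorphism and scaling, to $\mathcal{Q}_{2,s}$ for some $s>0$. 2. The left-invariant Lorentzian metric $\mathcal{Q}_3$ given by $x^2+2yz$ is complete and has a geodesic of unbounded velocity. A left-invariant Lorentzian metric on $\mathrm{Psh}$ is complete with a geodesic of unbounded velocity if and only if it is equivalent, up to automorphism and scaling, to $\mathcal{Q}_3$. -/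

import Mathlib

open scoped Matrix ContDiff

noncomputable section

/-- The matrix `C` whose one-parameter group `exp (t C)` acts on `ℝ²`. -/
def matC : Matrix (Fin 2) (Fin 2) ℝ := !![1, 1; 0, 1]

/-- The matrix `exp (t C)`, in closed form; see `expC_eq`. -/
def expC (t : ℝ) : Matrix (Fin 2) (Fin 2) ℝ := Real.exp t • !![1, t; 0, 1]

theorem expC_eq (t : ℝ) : expC t = NormedSpace.exp (t • matC) := by
  have hN : (t • !![0, 1; 0, 0] : Matrix (Fin 2) (Fin 2) ℝ) ^ 2 = 0 := by
    ext i j; fin_cases i <;> fin_cases j <;> simp [pow_two]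
  have hsum : t • matC
      = Matrix.diagonal (fun _ => t) + (t • !![0, 1; 0, 0] : Matrix (Fin 2) (Fin 2) ℝ) := by
    ext i j; fin_cases i <;> fin_cases j <;> simp [matC]
  have hcomm : Commute (Matrix.diagonal (fun _ => t) : Matrix (Fin 2) (Fin 2) ℝ)
      (t • !![0, 1; 0, 0]) := by
    ext i j; fin_cases i <;> fin_cases j <;> simp
  have hexpN : NormedSpace.exp (t • !![0, 1; 0, 0] : Matrix (Fin 2) (Fin 2) ℝ)
      = !![1, t; 0, 1] := by
    rw [congrFun (NormedSpace.exp_eq_tsum ℝ) _, tsum_eq_sum (s := Finset.range 2)]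
    · ext i j; fin_cases i <;> fin_cases j <;> simp [Finset.sum_range_succ]
    · intro n hn
      rw [pow_eq_zero_of_le (by simpa [Nat.succ_le_iff] using hn) hN, smul_zero]
  rw [hsum, Matrix.exp_add_of_commute _ _ hcomm, hexpN, Matrix.exp_diagonal]
  ext i j
  fin_cases i <;> fin_cases j <;>
    simp [expC, Matrix.mul_apply, Real.exp_eq_exp_ℝ, NormedSpace.exp_eq_tsum ℝ, Pi.exp_def]

/-- The pseudo-homothetic group `Psh = ℝ ⋉ ℝ²`, with its global coordinates
`(t, u) = (p 0, (p 1, p 2))`. As a manifold, it is the vector space `ℝ³`. -/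
def Psh : Type := Fin 3 → ℝ

namespace Psh

instance : NormedAddCommGroup Psh := inferInstanceAs (NormedAddCommGroup (Fin 3 → ℝ))

instance : NormedSpace ℝ Psh := inferInstanceAs (NormedSpace ℝ (Fin 3 → ℝ))

/-- The point with coordinates `(t, u)`. -/
def mk (t : ℝ) (u : Fin 2 → ℝ) : Psh := ![t, u 0, u 1]

/-- The `ℝ`-coordinate. -/
def time (p : Psh) : ℝ := p 0

/-- The `ℝ²`-coordinate. -/
def plane (p : Psh) : Fin 2 → ℝ := ![p 1, p 2]

/-- `(t, u) (t', u') = (t + t', u + exp (t C) u')`. -/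
instance : Mul Psh := ⟨fun p q => mk (time p + time q) (plane p + expC (time p) *ᵥ plane q)⟩

instance : One Psh := ⟨mk 0 0⟩

instance : Inv Psh := ⟨fun p => mk (-time p) (-(expC (-time p) *ᵥ plane p))⟩

theorem mul_apply_zero (p q : Psh) : (p * q) 0 = p 0 + q 0 := rfl

theorem mul_apply_one (p q : Psh) : (p * q) 1 = p 1 + Real.exp (p 0) * (q 1 + p 0 * q 2) := by
  change mk (time p + time q) (plane p + expC (time p) *ᵥ plane q) 1 = _
  simp [mk, time, plane, expC]
  ring

theorem mul_apply_two (p q : Psh) : (p * q) 2 = p 2 + Real.exp (p 0) * q 2 := by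
  change mk (time p + time q) (plane p + expC (time p) *ᵥ plane q) 2 = _
  simp [mk, time, plane, expC]
  ring

theorem inv_apply_zero (p : Psh) : p⁻¹ 0 = -p 0 := rfl

theorem inv_apply_one (p : Psh) : p⁻¹ 1 = -(Real.exp (-p 0) * (p 1 - p 0 * p 2)) := by
  change mk (-time p) (-(expC (-time p) *ᵥ plane p)) 1 = _
  simp [mk, time, plane, expC]
  ring

theorem inv_apply_two (p : Psh) : p⁻¹ 2 = -(Real.exp (-p 0) * p 2) := by
  change mk (-time p) (-(expC (-time p) *ᵥ plane p)) 2 = _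
  simp [mk, time, plane, expC]
  ring

theorem one_apply (i : Fin 3) : (1 : Psh) i = 0 := by
  fin_cases i <;> rfl

theorem ext {p q : Psh} (h0 : p 0 = q 0) (h1 : p 1 = q 1) (h2 : p 2 = q 2) : p = q := by
  funext i
  fin_cases i
  exacts [h0, h1, h2]

instance : Group Psh where
  mul_assoc p q r := by
    apply ext <;> simp only [mul_apply_zero, mul_apply_one, mul_apply_two, Real.exp_add] <;> ring
  one_mul p := by
    apply ext <;> simp [mul_apply_zero, mul_apply_one, mul_apply_two, one_apply]
  mul_one p := by
    apply ext <;> simp [mul_apply_zero, mul_apply_one, mul_apply_two, one_apply]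
  inv_mul_cancel p := by
    apply ext <;> simp only [mul_apply_zero, mul_apply_one, mul_apply_two, one_apply,
      inv_apply_zero, inv_apply_one, inv_apply_two] <;> ring

/-- The coordinate vectors `∂₁, ∂₂, ∂₃`. At the identity they form the basis `e₁, e₂, e₃` of the Lie
algebra with `[e₁, e₂] = e₂`, `[e₁, e₃] = e₂ + e₃`, `[e₂, e₃] = 0`. -/
def coordVec (i : Fin 3) : Psh := Pi.single (M := fun _ : Fin 3 => ℝ) i 1

/-- The Jacobian matrix at `p` of a map `φ : Psh → Psh`. -/
def jacobian (φ : Psh → Psh) (p : Psh) : Matrix (Fin 3) (Fin 3) ℝ :=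
  Matrix.of fun i j => fderiv ℝ φ p (coordVec j) i

/-- A field of bilinear forms on `Psh`, through its components
`g p i j = g_p (∂ᵢ, ∂ⱼ)` in the global coordinates. -/
abbrev TensorField : Type := Psh → Matrix (Fin 3) (Fin 3) ℝ

/-- The pullback `φ^* g`. -/
def pullback (φ : Psh → Psh) (g : TensorField) : TensorField :=
  fun p => (jacobian φ p)ᵀ * g (φ p) * jacobian φ p

/-- `g` is a (smooth) Lorentzian metric: symmetric, of signature `(-, +, +)` at each point. -/
structure IsLorentzian (g : TensorField) : Prop where
  smooth : ∀ i j, ContDiff ℝ ∞ (fun p => g p i j)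
  symm : ∀ p, (g p).IsSymm
  signature : ∀ p, ∃ P : Matrix (Fin 3) (Fin 3) ℝ,
    IsUnit P.det ∧ Pᵀ * g p * P = Matrix.diagonal ![-1, 1, 1]

/-- `g` is invariant under all left translations. -/
def IsLeftInvariant (g : TensorField) : Prop :=
  ∀ a : Psh, pullback (fun p => a * p) g = g

/-- The left-invariant field of bilinear forms with matrix `Q` in the basis `e₁, e₂, e₃` of the Lie
algebra: its value at `p` is the pullback of `Q` by the left translation by `p⁻¹`. -/
def leftInvariantField (Q : Matrix (Fin 3) (Fin 3) ℝ) : TensorField :=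
  fun p => (jacobian (fun q => p⁻¹ * q) p)ᵀ * Q * jacobian (fun q => p⁻¹ * q) p

/-- `Γᵏᵢⱼ = ½ ∑ₗ gᵏˡ (∂ᵢ gⱼₗ + ∂ⱼ gᵢₗ - ∂ₗ gᵢⱼ)`: the Christoffel symbols of the Levi-Civita
connection of `g` in the global coordinates. -/
def christoffel (g : TensorField) (p : Psh) (k i j : Fin 3) : ℝ :=
  (1 / 2) * ∑ l, (g p)⁻¹ k l *
    (fderiv ℝ (fun q => g q j l) p (coordVec i) + fderiv ℝ (fun q => g q i l) p (coordVec j)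
      - fderiv ℝ (fun q => g q i j) p (coordVec l))

/-- `γ : ℝ → Psh` is a geodesic (with affine parameter) of the Levi-Civita connection of `g`. -/
def IsGeodesic (g : TensorField) (γ : ℝ → Psh) : Prop :=
  ContDiff ℝ 2 γ ∧ ∀ t k, deriv (deriv γ) t k
    + ∑ i, ∑ j, christoffel g (γ t) k i j * deriv γ t i * deriv γ t j = 0

/-- `g` is geodesically complete: for all initial data there is a geodesic defined on all of `ℝ`. -/
def IsComplete (g : TensorField) : Prop :=
  ∀ p w : Psh, ∃ γ : ℝ → Psh, IsGeodesic g γ ∧ γ 0 = p ∧ deriv γ 0 = w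

/-- The velocity of a curve, left-translated to the Lie algebra (the tangent space at `1`):
`v t = D_{γ t} L_{(γ t)⁻¹} (γ' t)`. -/
def velocity (γ : ℝ → Psh) (t : ℝ) : Psh :=
  fderiv ℝ (fun q => (γ t)⁻¹ * q) (γ t) (deriv γ t)

/-- The left-translated velocity stays in a bounded subset of the Lie algebra. -/
def HasBoundedVelocity (γ : ℝ → Psh) : Prop :=
  ∃ M : ℝ, ∀ t, ‖velocity γ t‖ ≤ M

/-- `g` and `h` agree up to an automorphism of the Lie group `Psh` and scaling. -/
def AreEquivalent (g h : TensorField) : Prop :=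
  ∃ φ : Psh ≃* Psh, ContDiff ℝ ∞ φ ∧ ContDiff ℝ ∞ φ.symm ∧
    ∃ c : ℝ, c ≠ 0 ∧ pullback φ g = c • h

/-- The left-invariant metric `x² - y² + s z²`. -/
def Q2 (s : ℝ) : TensorField := leftInvariantField !![1, 0, 0; 0, -1, 0; 0, 0, s]

/-- The left-invariant metric `x² + 2 y z`. -/
def Q3 : TensorField := leftInvariantField !![1, 0, 0; 0, 0, 1; 0, 1, 0]

end Psh

end

/-!
A left-invariant field of bilinear forms is determined by its matrix `Q` at the identity, and its
components at `p` depend on the `ℝ`-coordinate of `p` only. Hence the geodesic equation of a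
left-invariant metric turns into the Euler–Arnold equation `m' = coad v m` for the left-translated
velocity `v` and the momentum `m = Q v` (`isGeodesic_iff`); completeness and boundedness of
velocities are properties of this quadratic differential equation on `ℝ³` (`isComplete_iff`,
`forall_hasBoundedVelocity_iff`). The differential at `1` of a smooth automorphism of `Psh` is an
automorphism of the Lie algebra, which has the form `autMat p q a b`, and all of these occur
(`areEquivalent_leftInvariantField_iff`). They act on the solutions of the Euler–Arnold
equations, so only normal forms matter.

Let `x = v 0`, let `T` be a primitive of `x`, and let `m₁, m₂` be the last two components of the
momentum. The translations of `ℝ²` are isometries, which gives two first integrals: `m₁ = exp T c₁`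
and `m₂ = exp T (c₂ + T c₁)` (`IsEulerArnold.exists_momentum`). If `e₁` is a unit vector orthogonal
to the plane spanned by `e₂, e₃`, conservation of energy becomes Newton's equation for `T` with a
potential `V` given by the dual form evaluated at `(m₁, m₂)`.
* For `Q2 s` and for `Q3` every such `V` is bounded below, so solutions are global
  (`exists_newton_solution`).
* For `Q2 s` the potential tends to infinity for `T → ∞` unless `m₁` vanishes, and then it is
  nonnegative; this bounds the velocity (`eulerArnoldBounded_Q2`). For `Q3` the potential vanishes
  if `c₁ = 0`, and `(1, exp t, 0)` is an unbounded solution.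
* In all other normal forms, suitable initial values lead to the Riccati inequality `x' ≥ x²`, and
  the solution blows up.

`classification` brings the matrix of a Lorentzian form into one of the normal forms by completing
squares, according to whether its restriction to the plane spanned by `e₂, e₃` is degenerate and
whether `e₂` is null.
-/

noncomputable section

namespace Psh

/-! ### Calculus in the global coordinates -/


/-- The `i`-th coordinate, as a continuous linear form. -/
def coordCLM (i : Fin 3) : Psh →L[ℝ] ℝ :=
  ContinuousLinearMap.proj (R := ℝ) (φ := fun _ : Fin 3 => ℝ) i

theorem coordCLM_apply (i : Fin 3) (p : Psh) : coordCLM i p = p i := rfl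

theorem coordVec_apply (i j : Fin 3) : coordVec i j = if j = i then 1 else 0 := by
  change (Pi.single i 1 : Fin 3 → ℝ) j = _
  rw [Pi.single_apply]

theorem hasFDerivAt_iff {E : Type*} [NormedAddCommGroup E] [NormedSpace ℝ E] {f : E → Psh}
    {f' : E →L[ℝ] Psh} {x : E} :
    HasFDerivAt f f' x ↔ ∀ i, HasFDerivAt (fun y => f y i) ((coordCLM i).comp f') x :=
  hasFDerivAt_pi' (F' := fun _ : Fin 3 => ℝ)

theorem hasDerivAt_iff {γ : ℝ → Psh} {w : Psh} {t : ℝ} :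
    HasDerivAt γ w t ↔ ∀ i, HasDerivAt (fun s => γ s i) (w i) t :=
  hasDerivAt_pi (E' := fun _ : Fin 3 => ℝ)

theorem contDiff_iff {E : Type*} [NormedAddCommGroup E] [NormedSpace ℝ E] {n : WithTop ℕ∞}
    {f : E → Psh} : ContDiff ℝ n f ↔ ∀ i, ContDiff ℝ n (fun x => f x i) :=
  contDiff_pi (F' := fun _ : Fin 3 => ℝ)

theorem hasFDerivAt_coord (i : Fin 3) (p : Psh) :
    HasFDerivAt (fun q : Psh => q i) (coordCLM i) p := (coordCLM i).hasFDerivAt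

theorem contDiff_coord {n : WithTop ℕ∞} (i : Fin 3) : ContDiff ℝ n (fun q : Psh => q i) :=
  (coordCLM i).contDiff

theorem eq_sum_coordVec (p : Psh) : p = p 0 • coordVec 0 + p 1 • coordVec 1 + p 2 • coordVec 2 := by
  have h (i : Fin 3) : (p 0 • coordVec 0 + p 1 • coordVec 1 + p 2 • coordVec 2 : Psh) i
    = p 0 * coordVec 0 i + p 1 * coordVec 1 i + p 2 * coordVec 2 i := rfl
  apply ext <;> rw [h] <;> simp [coordVec_apply]

/-- The linear endomorphism with matrix `M` in the basis of the coordinate vectors. -/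
def matCLM (M : Matrix (Fin 3) (Fin 3) ℝ) : Psh →L[ℝ] Psh :=
  ContinuousLinearMap.pi (φ := fun _ : Fin 3 => ℝ)
    fun i => M i 0 • coordCLM 0 + M i 1 • coordCLM 1 + M i 2 • coordCLM 2

theorem matCLM_apply (M : Matrix (Fin 3) (Fin 3) ℝ) (p : Psh) (i : Fin 3) :
    matCLM M p i = M i 0 * p 0 + M i 1 * p 1 + M i 2 * p 2 := rfl

theorem hasFDerivAt_matCLM {φ : Psh → Psh} {M : Matrix (Fin 3) (Fin 3) ℝ} {p : Psh}
    {l₀ l₁ l₂ : Psh →L[ℝ] ℝ} (h₀ : HasFDerivAt (fun q => φ q 0) l₀ p)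
    (h₁ : HasFDerivAt (fun q => φ q 1) l₁ p) (h₂ : HasFDerivAt (fun q => φ q 2) l₂ p)
    (e₀ : ∀ q, l₀ q = M 0 0 * q 0 + M 0 1 * q 1 + M 0 2 * q 2)
    (e₁ : ∀ q, l₁ q = M 1 0 * q 0 + M 1 1 * q 1 + M 1 2 * q 2)
    (e₂ : ∀ q, l₂ q = M 2 0 * q 0 + M 2 1 * q 1 + M 2 2 * q 2) :
    HasFDerivAt φ (matCLM M) p := by
  rw [hasFDerivAt_iff]
  intro i
  fin_cases i
  · exact h₀.congr_fderiv (ContinuousLinearMap.ext e₀)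
  · exact h₁.congr_fderiv (ContinuousLinearMap.ext e₁)
  · exact h₂.congr_fderiv (ContinuousLinearMap.ext e₂)

theorem jacobian_eq_of_hasFDerivAt {φ : Psh → Psh} {M : Matrix (Fin 3) (Fin 3) ℝ} {p : Psh}
    (h : HasFDerivAt φ (matCLM M) p) : jacobian φ p = M := by
  ext i j
  simp only [jacobian, Matrix.of_apply, h.fderiv, matCLM_apply, coordVec_apply]
  fin_cases j <;> simp

theorem hasFDerivAt_jacobian {φ : Psh → Psh} {p : Psh}
    (h : DifferentiableAt ℝ φ p) : HasFDerivAt φ (matCLM (jacobian φ p)) p := by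
  convert h.hasFDerivAt
  ext1 q
  conv_rhs => rw [eq_sum_coordVec q]
  simp only [map_add, map_smul]
  funext i
  rw [matCLM_apply]
  change _ = q 0 * fderiv ℝ φ p (coordVec 0) i + q 1 * fderiv ℝ φ p (coordVec 1) i
    + q 2 * fderiv ℝ φ p (coordVec 2) i
  simp only [jacobian, Matrix.of_apply]
  ring

theorem jacobian_comp {φ ψ : Psh → Psh} {p : Psh} (hφ : DifferentiableAt ℝ φ (ψ p))
    (hψ : DifferentiableAt ℝ ψ p) :
    jacobian (fun q => φ (ψ q)) p = jacobian φ (ψ p) * jacobian ψ p := by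
  apply jacobian_eq_of_hasFDerivAt
  refine ((hasFDerivAt_jacobian hφ).comp p
    (hasFDerivAt_jacobian hψ)).congr_fderiv ?_
  ext1 q
  funext i
  simp only [ContinuousLinearMap.comp_apply, matCLM_apply, Matrix.mul_apply, Fin.sum_univ_three]
  ring

/-- The matrix `diag (1, exp (a C))`: the differential, in coordinates, of the left translation by
any group element whose `ℝ`-coordinate is `a`. -/
def transMat (a : ℝ) : Matrix (Fin 3) (Fin 3) ℝ :=
  !![1, 0, 0; 0, Real.exp a, a * Real.exp a; 0, 0, Real.exp a]

theorem transMat_zero : transMat 0 = 1 := by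
  ext i j; fin_cases i <;> fin_cases j <;> simp [transMat]

theorem transMat_add (a b : ℝ) : transMat (a + b) = transMat a * transMat b := by
  ext i j; fin_cases i <;> fin_cases j <;>
    simp [transMat, Matrix.mul_apply, Fin.sum_univ_three, Real.exp_add]
  ring

theorem transMat_neg_mul (a : ℝ) : transMat (-a) * transMat a = 1 := by
  rw [← transMat_add, neg_add_cancel, transMat_zero]

theorem transMat_mul_neg (a : ℝ) : transMat a * transMat (-a) = 1 := by
  rw [← transMat_add, add_neg_cancel, transMat_zero]

theorem hasFDerivAt_mul_left (a p : Psh) :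
    HasFDerivAt (fun q => a * q) (matCLM (transMat (a 0))) p := by
  have h0 := hasFDerivAt_coord 0 p
  have h1 := hasFDerivAt_coord 1 p
  have h2 := hasFDerivAt_coord 2 p
  refine hasFDerivAt_matCLM (h0.const_add (a 0)) (l₁ := ?_) (l₂ := ?_) ?_ ?_ ?_ ?_ ?_
  rotate_left 2
  · simp only [mul_apply_one]
    exact ((h1.add (h2.const_mul (a 0))).const_mul (Real.exp (a 0))).const_add (a 1)
  · simp only [mul_apply_two]
    exact (h2.const_mul (Real.exp (a 0))).const_add (a 2)
  all_goals
    intro q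
    simp [transMat, coordCLM_apply]
    try ring

theorem jacobian_mul_left (a p : Psh) : jacobian (fun q => a * q) p = transMat (a 0) :=
  jacobian_eq_of_hasFDerivAt (hasFDerivAt_mul_left a p)

theorem contDiff_mul_left {n : WithTop ℕ∞} (a : Psh) : ContDiff ℝ n (fun q => a * q) := by
  rw [contDiff_iff]
  have h0 := contDiff_coord (n := n) 0
  have h1 := contDiff_coord (n := n) 1
  have h2 := contDiff_coord (n := n) 2
  intro i
  fin_cases i
  · exact contDiff_const.add h0
  · simp only [Fin.mk_one, mul_apply_one]
    exact contDiff_const.add (contDiff_const.mul (h1.add (contDiff_const.mul h2)))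
  · simp only [Fin.reduceFinMk, mul_apply_two]
    exact contDiff_const.add (contDiff_const.mul h2)

theorem contDiff_mul_right {n : WithTop ℕ∞} (a : Psh) : ContDiff ℝ n (fun q => q * a) := by
  rw [contDiff_iff]
  have h0 := contDiff_coord (n := n) 0
  have h1 := contDiff_coord (n := n) 1
  have h2 := contDiff_coord (n := n) 2
  intro i
  fin_cases i
  · exact h0.add contDiff_const
  · simp only [Fin.mk_one, mul_apply_one]
    exact h1.add (h0.exp.mul (contDiff_const.add (h0.mul contDiff_const)))
  · simp only [Fin.reduceFinMk, mul_apply_two]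
    exact h2.add (h0.exp.mul contDiff_const)

/-- The matrix of `Ad p`. -/
def adMat (p : Psh) : Matrix (Fin 3) (Fin 3) ℝ :=
  !![1, 0, 0; -(p 1 + p 2), Real.exp (p 0), p 0 * Real.exp (p 0); -p 2, 0, Real.exp (p 0)]

theorem hasFDerivAt_conj (p : Psh) :
    HasFDerivAt (fun q => p * q * p⁻¹) (matCLM (adMat p)) 1 := by
  have h0 := hasFDerivAt_coord 0 1
  have h1 := hasFDerivAt_coord 1 1
  have h2 := hasFDerivAt_coord 2 1
  have e : Real.exp (-p 0) * Real.exp (p 0) = 1 := by rw [← Real.exp_add]; simp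
  have e1 : (fun q : Psh => (p * q * p⁻¹) 1) = fun q => p 1 + Real.exp (p 0) * (q 1 + p 0 * q 2)
      - Real.exp (q 0) * (p 1 + q 0 * p 2) := by
    funext q
    simp only [mul_apply_zero, mul_apply_one, inv_apply_one, inv_apply_two, Real.exp_add]
    linear_combination (-Real.exp (q 0) * (p 1 + q 0 * p 2)) * e
  have e2 : (fun q : Psh => (p * q * p⁻¹) 2) = fun q => p 2 + Real.exp (p 0) * q 2
      - Real.exp (q 0) * p 2 := by
    funext q
    simp only [mul_apply_zero, mul_apply_two, inv_apply_two, Real.exp_add]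
    linear_combination (-Real.exp (q 0) * p 2) * e
  refine hasFDerivAt_matCLM ((h0.const_add (p 0)).add_const (-p 0)) (l₁ := ?_) (l₂ := ?_)
    ?_ ?_ ?_ ?_ ?_
  rotate_left 2
  · rw [e1]
    exact (((h1.add (h2.const_mul (p 0))).const_mul (Real.exp (p 0))).const_add (p 1)).sub
      (h0.exp.mul ((h0.mul_const (p 2)).const_add (p 1)))
  · rw [e2]
    exact ((h2.const_mul (Real.exp (p 0))).const_add (p 2)).sub (h0.exp.mul_const (p 2))
  all_goals
    intro q
    simp [adMat, coordCLM_apply, one_apply]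
    try ring

/-! ### Left-invariant fields -/


theorem leftInvariantField_apply (Q : Matrix (Fin 3) (Fin 3) ℝ) (p : Psh) :
    leftInvariantField Q p = (transMat (-p 0))ᵀ * Q * transMat (-p 0) := by
  rw [leftInvariantField, jacobian_mul_left, inv_apply_zero]

theorem leftInvariantField_one (Q : Matrix (Fin 3) (Fin 3) ℝ) : leftInvariantField Q 1 = Q := by
  rw [leftInvariantField_apply, one_apply, neg_zero, transMat_zero]
  simp

theorem isLeftInvariant_leftInvariantField (Q : Matrix (Fin 3) (Fin 3) ℝ) :
    IsLeftInvariant (leftInvariantField Q) := by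
  intro a
  funext p
  have h : transMat (-p 0) = transMat (-(a * p) 0) * transMat (a 0) := by
    rw [← transMat_add, mul_apply_zero]
    congr 1
    ring
  rw [pullback, jacobian_mul_left, leftInvariantField_apply, leftInvariantField_apply, h,
    Matrix.transpose_mul]
  simp only [Matrix.mul_assoc]

theorem IsLeftInvariant.eq_leftInvariantField {g : TensorField} (hg : IsLeftInvariant g) :
    g = leftInvariantField (g 1) := by
  funext p
  have h := congrFun (hg p⁻¹) p
  rw [pullback, jacobian_mul_left, inv_mul_cancel] at h
  rw [leftInvariantField, jacobian_mul_left, h]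

theorem isLorentzian_leftInvariantField {Q P : Matrix (Fin 3) (Fin 3) ℝ} (hQ : Q.IsSymm)
    (hP : IsUnit P.det) (h : Pᵀ * Q * P = Matrix.diagonal ![-1, 1, 1]) :
    IsLorentzian (leftInvariantField Q) where
  smooth i j := by
    have h0 := contDiff_coord (n := ∞) 0
    have key : ∀ k l, ContDiff ℝ ∞ fun p : Psh => transMat (-p 0) k l := by
      intro k l
      fin_cases k <;> fin_cases l <;> simp [transMat] <;>
        first
        | exact contDiff_const
        | exact (h0.neg).exp
        | exact (h0.mul (h0.neg).exp).neg
    simp only [leftInvariantField_apply, Matrix.mul_apply, Matrix.transpose_apply]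
    exact ContDiff.sum fun k _ => (ContDiff.sum fun l _ => (key _ _).mul contDiff_const).mul
      (key _ _)
  symm p := by
    rw [leftInvariantField_apply, Matrix.IsSymm, Matrix.transpose_mul, Matrix.transpose_mul,
      Matrix.transpose_transpose, hQ.eq, Matrix.mul_assoc]
  signature p := by
    refine ⟨transMat (p 0) * P, ?_, ?_⟩
    · rw [Matrix.det_mul]
      refine IsUnit.mul ?_ hP
      rw [isUnit_iff_ne_zero]
      intro h0
      have := congrArg Matrix.det (transMat_neg_mul (p 0))
      rw [Matrix.det_mul, h0] at this
      simp at this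
    · rw [leftInvariantField_apply, ← h]
      calc _ = Pᵀ * (transMat (-p 0) * transMat (p 0))ᵀ * Q * (transMat (-p 0) * transMat (p 0))
            * P := by simp only [Matrix.transpose_mul, Matrix.mul_assoc]
        _ = _ := by rw [transMat_neg_mul]; simp

/-! ### Automorphisms -/

/-- The matrix of the automorphism of the Lie algebra that sends `e₁` to `e₁ + p e₂ + q e₃` and acts
on the plane spanned by `e₂, e₃` as `a + b (C - 1)`. -/
def autMat (p q a b : ℝ) : Matrix (Fin 3) (Fin 3) ℝ := !![1, 0, 0; p, a, b; q, 0, a]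

theorem zero_eq_one : (0 : Psh) = 1 := by
  apply ext <;> rw [one_apply] <;> rfl

theorem jacobian_inv_mul {φ : Psh ≃* Psh} (h : Differentiable ℝ φ)
    (h' : Differentiable ℝ φ.symm) : jacobian φ.symm 1 * jacobian φ 1 = 1 := by
  have := jacobian_comp (φ := φ.symm) (ψ := φ) (p := 1) (h' _) (h _)
  rw [map_one] at this
  rw [← this]
  apply jacobian_eq_of_hasFDerivAt
  simp only [MulEquiv.symm_apply_apply]
  refine hasFDerivAt_matCLM (hasFDerivAt_coord 0 1) (hasFDerivAt_coord 1 1)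
    (hasFDerivAt_coord 2 1) ?_ ?_ ?_ <;> intro q <;> simp [coordCLM_apply]

/-- The differential at `1` of a homomorphism intertwines the adjoint representations. -/
theorem jacobian_mul_adMat {φ : Psh ≃* Psh} (h : Differentiable ℝ φ) (p : Psh) :
    jacobian φ 1 * adMat p = adMat (φ p) * jacobian φ 1 := by
  have h1 := jacobian_comp (φ := φ) (ψ := fun q => p * q * p⁻¹) (p := 1) (h _)
    (hasFDerivAt_conj p).differentiableAt
  have h2 := jacobian_comp (φ := fun q => φ p * q * (φ p)⁻¹) (ψ := φ) (p := 1)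
    (by rw [map_one]; exact (hasFDerivAt_conj (φ p)).differentiableAt) (h _)
  simp only [mul_one, mul_inv_cancel, map_one,
    jacobian_eq_of_hasFDerivAt (hasFDerivAt_conj _)] at h1 h2
  rw [← h1, ← h2]
  simp only [map_mul, map_inv]

/-- The differential at `1` of a smooth automorphism of `Psh` has the form `autMat`. Compare its
values on `Ad (t, 0) = diag (1, exp (t C))`: the eigenvalues force `φ (t, 0)` to have the
`ℝ`-coordinate `t`, and the differential to commute with `C` on the plane. -/
theorem exists_jacobian_eq_autMat {φ : Psh ≃* Psh} (h : Differentiable ℝ φ)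
    (h' : Differentiable ℝ φ.symm) : ∃ p q a b, a ≠ 0 ∧ jacobian φ 1 = autMat p q a b := by
  set A := jacobian φ 1 with hA
  have hdet : A.det ≠ 0 := by
    intro h0
    have := congrArg Matrix.det (jacobian_inv_mul h h')
    rw [Matrix.det_mul, ← hA, h0] at this
    simp at this
  have key : ∀ t : ℝ, t ≠ 0 → A 0 1 = 0 ∧ A 0 2 = 0 ∧ A 2 1 = 0 ∧ A 2 2 = A 1 1 ∧
      φ (t • coordVec 0) 0 = t := by
    intro t ht
    set r := φ (t • coordVec 0) with hr
    have hE := jacobian_mul_adMat h (t • coordVec 0)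
    rw [← hA, ← hr] at hE
    have c0 : (t • coordVec 0 : Psh) 0 = t := by
      change t * coordVec 0 0 = t
      simp [coordVec_apply]
    have c1 : (t • coordVec 0 : Psh) 1 = 0 := by
      change t * coordVec 0 1 = 0
      simp [coordVec_apply]
    have c2 : (t • coordVec 0 : Psh) 2 = 0 := by
      change t * coordVec 0 2 = 0
      simp [coordVec_apply]
    have hE' : ∀ i j, (A * adMat (t • coordVec 0)) i j = (adMat r * A) i j := by
      intro i j; rw [hE]
    simp only [Matrix.mul_apply, Fin.sum_univ_three, adMat, c0, c1, c2] at hE'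
    have e01 := hE' 0 1
    have e02 := hE' 0 2
    have e11 := hE' 1 1
    have e12 := hE' 1 2
    have e21 := hE' 2 1
    have e22 := hE' 2 2
    simp at e01 e02 e11 e12 e21 e22
    have het : Real.exp t ≠ 1 := by simpa using ht
    have hp := Real.exp_pos t
    have a01 : A 0 1 = 0 := by
      have : A 0 1 * (Real.exp t - 1) = 0 := by linear_combination e01
      exact (mul_eq_zero.1 this).resolve_right (sub_ne_zero.2 het)
    have a02 : A 0 2 = 0 := by
      have : A 0 2 * (Real.exp t - 1) = 0 := by
        rw [a01] at e02; linear_combination e02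
      exact (mul_eq_zero.1 this).resolve_right (sub_ne_zero.2 het)
    simp only [a01, a02, mul_zero, zero_add] at e11 e12 e21 e22
    have a21 : A 2 1 = 0 := by
      by_contra hne
      have hexp : Real.exp t = Real.exp (r 0) := by
        apply mul_left_cancel₀ hne
        linear_combination e21
      have hrt : r 0 = t := (Real.exp_injective hexp).symm
      rw [hrt] at e11
      have : t * Real.exp t * A 2 1 = 0 := by linear_combination -e11
      exact hne ((mul_eq_zero.1 this).resolve_left (mul_ne_zero ht hp.ne'))
    rw [Matrix.det_fin_three, a01, a02, a21] at hdet
    have a22 : A 2 2 ≠ 0 := by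
      intro h0; apply hdet; rw [h0]; ring
    have hrt : r 0 = t := by
      have hexp : Real.exp t = Real.exp (r 0) := by
        apply mul_left_cancel₀ a22
        rw [a21] at e22
        linear_combination e22
      exact (Real.exp_injective hexp).symm
    refine ⟨a01, a02, a21, ?_, hrt⟩
    rw [hrt] at e12
    have : t * Real.exp t * (A 2 2 - A 1 1) = 0 := by linear_combination -e12
    exact sub_eq_zero.1 ((mul_eq_zero.1 this).resolve_left (mul_ne_zero ht hp.ne'))
  obtain ⟨a01, a02, a21, a22, -⟩ := key 1 one_ne_zero
  -- the curve `t ↦ φ (t e₁)` has `ℝ`-coordinate `t`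
  have a00 : A 0 0 = 1 := by
    have hφ : HasFDerivAt (fun q => φ q 0) ((coordCLM 0).comp (matCLM A)) 0 := by
      have := hasFDerivAt_iff.1 (hasFDerivAt_jacobian (h 0)) 0
      rwa [zero_eq_one, ← hA, ← zero_eq_one] at this
    have hl : HasDerivAt (fun t : ℝ => t • coordVec 0) (coordVec 0) 0 := by
      simpa using (hasDerivAt_id (0 : ℝ)).smul_const (coordVec 0)
    have hc := HasFDerivAt.comp_hasDerivAt_of_eq (0 : ℝ) hφ hl (by simp)
    have he : (fun q => φ q 0) ∘ (fun t : ℝ => t • coordVec 0) = fun t => t := by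
      funext t
      by_cases ht : t = 0
      · rw [ht]
        have : φ ((0 : ℝ) • coordVec 0) = 1 := by
          rw [zero_smul, zero_eq_one]; exact map_one φ
        change φ ((0 : ℝ) • coordVec 0) 0 = 0
        rw [this, one_apply]
      · exact (key t ht).2.2.2.2
    rw [he] at hc
    have := hc.unique (hasDerivAt_id 0)
    change matCLM A (coordVec 0) 0 = 1 at this
    rw [matCLM_apply] at this
    simpa [coordVec_apply] using this
  refine ⟨A 1 0, A 2 0, A 1 1, A 1 2, ?_, ?_⟩
  · intro h0
    apply hdet
    rw [Matrix.det_fin_three, a01, a02, a21, h0]; ring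
  · ext i j
    fin_cases i <;> fin_cases j <;> simp [autMat, a00, a01, a02, a21, a22]

/-- The automorphism of `Psh` that is the identity on `ℝ` and `a + b (C - 1)` on `ℝ²`. -/
def planeAut (a b : ℝ) (ha : a ≠ 0) : Psh ≃* Psh where
  toFun p := mk (p 0) ![a * p 1 + b * p 2, a * p 2]
  invFun p := mk (p 0) ![a⁻¹ * p 1 - b * a⁻¹ ^ 2 * p 2, a⁻¹ * p 2]
  left_inv p := by
    apply ext <;> simp [mk] <;> field_simp
    ring
  right_inv p := by
    apply ext <;> simp [mk] <;> field_simp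
    ring
  map_mul' p q := by
    apply ext <;> simp only [mul_apply_zero, mul_apply_one, mul_apply_two] <;> simp [mk] <;> ring

theorem planeAut_symm_apply (a b : ℝ) (ha : a ≠ 0) (p : Psh) :
    (planeAut a b ha).symm p = mk (p 0) ![a⁻¹ * p 1 - b * a⁻¹ ^ 2 * p 2, a⁻¹ * p 2] := rfl

theorem contDiff_mk_linear {n : WithTop ℕ∞} (a b c : ℝ) :
    ContDiff ℝ n fun p : Psh => mk (p 0) ![a * p 1 + b * p 2, c * p 2] := by
  rw [contDiff_iff]
  have h0 := contDiff_coord (n := n) 0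
  have h1 := contDiff_coord (n := n) 1
  have h2 := contDiff_coord (n := n) 2
  intro i
  fin_cases i
  · exact h0
  · exact (contDiff_const.mul h1).add (contDiff_const.mul h2)
  · exact contDiff_const.mul h2

theorem contDiff_planeAut {n : WithTop ℕ∞} (a b : ℝ) (ha : a ≠ 0) :
    ContDiff ℝ n (planeAut a b ha) := contDiff_mk_linear a b a

theorem contDiff_planeAut_symm {n : WithTop ℕ∞} (a b : ℝ) (ha : a ≠ 0) :
    ContDiff ℝ n (planeAut a b ha).symm := by
  convert contDiff_mk_linear (n := n) a⁻¹ (-(b * a⁻¹ ^ 2)) a⁻¹ using 1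
  funext p
  rw [planeAut_symm_apply]
  congr 2
  ring

theorem jacobian_planeAut (a b : ℝ) (ha : a ≠ 0) (p : Psh) :
    jacobian (planeAut a b ha) p = autMat 0 0 a b := by
  apply jacobian_eq_of_hasFDerivAt
  have h1 := hasFDerivAt_coord 1 p
  have h2 := hasFDerivAt_coord 2 p
  refine hasFDerivAt_matCLM (hasFDerivAt_coord 0 p) ((h1.const_mul a).add (h2.const_mul b))
    (h2.const_mul a) ?_ ?_ ?_ <;> intro q <;> simp [coordCLM_apply, autMat]

theorem contDiff_conj {n : WithTop ℕ∞} (p : Psh) : ContDiff ℝ n (fun q => p * q * p⁻¹) :=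
  (contDiff_mul_right p⁻¹).comp (contDiff_mul_left p)

/-- Every automorphism of the Lie algebra of the form `autMat` integrates to the group: compose an
automorphism `planeAut` with an inner one. -/
theorem exists_mulEquiv_jacobian_eq (p q a b : ℝ) (ha : a ≠ 0) :
    ∃ φ : Psh ≃* Psh, ContDiff ℝ ∞ φ ∧ ContDiff ℝ ∞ φ.symm ∧
      jacobian φ 1 = autMat p q a b := by
  -- conjugation by `(0, u)` sends `e₁` to `e₁ - C u`
  let r : Psh := mk 0 ![q - p, -q]
  refine ⟨(planeAut a b ha).trans (MulAut.conj r), ?_, ?_, ?_⟩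
  · exact (contDiff_conj r).comp (contDiff_planeAut a b ha)
  · have := (contDiff_planeAut_symm (n := ∞) a b ha).comp (contDiff_conj r⁻¹)
    rw [inv_inv] at this
    exact this
  · have hone : planeAut a b ha 1 = 1 := map_one _
    have := jacobian_comp (φ := fun q => r * q * r⁻¹) (ψ := planeAut a b ha) (p := 1)
      ((contDiff_conj (n := 1) r).differentiable one_ne_zero _)
      ((contDiff_planeAut (n := 1) a b ha).differentiable one_ne_zero _)
    rw [hone, jacobian_planeAut, jacobian_eq_of_hasFDerivAt (hasFDerivAt_conj r)] at this
    change jacobian (fun x => r * planeAut a b ha x * r⁻¹) 1 = _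
    rw [this]
    ext i j
    fin_cases i <;> fin_cases j <;>
      simp [autMat, adMat, Matrix.mul_apply, Fin.sum_univ_three, r, mk]

/-- Pulling back a left-invariant field by an automorphism amounts to a change of basis by its
differential at `1`. -/
theorem pullback_leftInvariantField {φ : Psh ≃* Psh} (h : Differentiable ℝ φ)
    (N : Matrix (Fin 3) (Fin 3) ℝ) :
    pullback φ (leftInvariantField N)
      = leftInvariantField ((jacobian φ 1)ᵀ * N * jacobian φ 1) := by
  funext p
  -- `φ ∘ L_{p⁻¹} = L_{φ(p)⁻¹} ∘ φ`
  have h1 := jacobian_comp (φ := φ) (ψ := fun q => p⁻¹ * q) (p := p) (h _)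
    (hasFDerivAt_mul_left _ _).differentiableAt
  have h2 := jacobian_comp (φ := fun q => (φ p)⁻¹ * q) (ψ := φ) (p := p)
    (hasFDerivAt_mul_left _ _).differentiableAt (h _)
  simp only [inv_mul_cancel] at h1
  have h3 : jacobian φ 1 * jacobian (fun q => p⁻¹ * q) p
      = jacobian (fun q => (φ p)⁻¹ * q) (φ p) * jacobian φ p := by
    rw [← h1, ← h2]
    simp only [map_mul, map_inv]
  simp only [pullback, leftInvariantField]
  calc _ = (jacobian (fun q => (φ p)⁻¹ * q) (φ p) * jacobian φ p)ᵀ * N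
        * (jacobian (fun q => (φ p)⁻¹ * q) (φ p) * jacobian φ p) := by
        simp only [Matrix.transpose_mul, Matrix.mul_assoc]
    _ = _ := by
        rw [← h3]
        simp only [Matrix.transpose_mul, Matrix.mul_assoc]

theorem leftInvariantField_smul (c : ℝ) (Q : Matrix (Fin 3) (Fin 3) ℝ) :
    leftInvariantField (c • Q) = c • leftInvariantField Q := by
  funext p
  simp [leftInvariantField]

theorem areEquivalent_leftInvariantField_iff {N Q : Matrix (Fin 3) (Fin 3) ℝ} :
    AreEquivalent (leftInvariantField N) (leftInvariantField Q) ↔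
      ∃ p q a b c : ℝ, a ≠ 0 ∧ c ≠ 0 ∧ (autMat p q a b)ᵀ * N * autMat p q a b = c • Q := by
  constructor
  · rintro ⟨φ, hφ, hφ', c, hc, h⟩
    have hd : Differentiable ℝ φ := hφ.differentiable (by simp)
    obtain ⟨p, q, a, b, ha, hA⟩ :=
      exists_jacobian_eq_autMat hd (hφ'.differentiable (by simp))
    refine ⟨p, q, a, b, c, ha, hc, ?_⟩
    rw [pullback_leftInvariantField hd, hA, ← leftInvariantField_smul] at h
    simpa only [leftInvariantField_one] using congrFun h 1
  · rintro ⟨p, q, a, b, c, ha, hc, h⟩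
    obtain ⟨φ, hφ, hφ', hA⟩ := exists_mulEquiv_jacobian_eq p q a b ha
    refine ⟨φ, hφ, hφ', c, hc, ?_⟩
    rw [pullback_leftInvariantField (hφ.differentiable (by simp)), hA, h, leftInvariantField_smul]

/-! ### The geodesic equation of a left-invariant metric -/


/-- The coadjoint action of `v` on the linear form `m`: the form `w ↦ m [v, w]`, in coordinates. -/
def coad (v m : Fin 3 → ℝ) : Fin 3 → ℝ :=
  ![-(v 1 + v 2) * m 1 - v 2 * m 2, v 0 * m 1, v 0 * (m 1 + m 2)]

/-- The Euler–Arnold equation on the Lie algebra of `Psh`, for the bilinear form with matrix `Q`: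
the momentum `m = Q v` of the velocity `v` satisfies `m' = coad v m`. -/
def IsEulerArnold (Q : Matrix (Fin 3) (Fin 3) ℝ) (v : ℝ → Fin 3 → ℝ) : Prop :=
  ∀ t, HasDerivAt (fun s => Q *ᵥ v s) (coad (v t) (Q *ᵥ v t)) t

/-- The matrix of `ad e₁`, which is minus the logarithmic derivative of `a ↦ transMat (-a)`. -/
def adOne : Matrix (Fin 3) (Fin 3) ℝ := !![0, 0, 0; 0, 1, 1; 0, 0, 1]

theorem adOne_mul_transMat (a : ℝ) : adOne * transMat a = transMat a * adOne := by
  ext i j; fin_cases i <;> fin_cases j <;>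
    simp [adOne, transMat, Matrix.mul_apply, Fin.sum_univ_three]
  ring

theorem hasDerivAt_transMat_neg (a : ℝ) (i j : Fin 3) :
    HasDerivAt (fun s => transMat (-s) i j) (-(adOne * transMat (-a)) i j) a := by
  have h1 : HasDerivAt (fun s : ℝ => Real.exp (-s)) (-Real.exp (-a)) a := by
    simpa using (hasDerivAt_neg a).exp
  have h2 : HasDerivAt (fun s : ℝ => -(s * Real.exp (-s)))
      (-(1 * Real.exp (-a) + a * -Real.exp (-a))) a :=
    ((hasDerivAt_id a).mul h1).neg
  fin_cases i <;> fin_cases j <;>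
    simp [transMat, adOne, Matrix.mul_apply, Fin.sum_univ_three, hasDerivAt_const] <;>
    first
    | exact h1
    | (convert h2 using 1; ring)

theorem hasDerivAt_transMat_conj (Q : Matrix (Fin 3) (Fin 3) ℝ) (a : ℝ) (i j : Fin 3) :
    HasDerivAt (fun s => ((transMat (-s))ᵀ * Q * transMat (-s)) i j)
      (-(adOneᵀ * ((transMat (-a))ᵀ * Q * transMat (-a))
        + (transMat (-a))ᵀ * Q * transMat (-a) * adOne) i j) a := by
  have h : HasDerivAt (fun s => ∑ k, (∑ l, transMat (-s) l i * Q l k) * transMat (-s) k j)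
      (∑ k, ((∑ l, -(adOne * transMat (-a)) l i * Q l k) * transMat (-a) k j
        + (∑ l, transMat (-a) l i * Q l k) * -(adOne * transMat (-a)) k j)) a :=
    HasDerivAt.fun_sum fun k _ => (HasDerivAt.fun_sum fun l _ =>
      (hasDerivAt_transMat_neg a l i).mul_const (Q l k)).mul (hasDerivAt_transMat_neg a k j)
  have e : adOneᵀ * ((transMat (-a))ᵀ * Q * transMat (-a))
        + (transMat (-a))ᵀ * Q * transMat (-a) * adOne
      = (adOne * transMat (-a))ᵀ * Q * transMat (-a)
        + (transMat (-a))ᵀ * Q * (adOne * transMat (-a)) := by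
    rw [adOne_mul_transMat, Matrix.transpose_mul]
    simp only [Matrix.mul_assoc]
  rw [e]
  convert h using 1
  · simp only [Matrix.mul_apply, Matrix.transpose_apply]
  · simp only [Matrix.add_apply, Matrix.mul_apply, Matrix.transpose_apply, Finset.sum_add_distrib,
      neg_mul, mul_neg, Finset.sum_neg_distrib, neg_add]

/-- The components of a left-invariant field depend on the `ℝ`-coordinate only. -/
theorem fderiv_leftInvariantField (Q : Matrix (Fin 3) (Fin 3) ℝ) (p : Psh) (i j k : Fin 3) :
    fderiv ℝ (fun q => leftInvariantField Q q i j) p (coordVec k)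
      = (if k = 0 then 1 else 0) *
        -(adOneᵀ * leftInvariantField Q p + leftInvariantField Q p * adOne) i j := by
  have h := (hasDerivAt_transMat_conj Q (p 0) i j).comp_hasFDerivAt p (hasFDerivAt_coord 0 p)
  have e : (fun q => leftInvariantField Q q i j)
      = (fun s => ((transMat (-s))ᵀ * Q * transMat (-s)) i j) ∘ fun q : Psh => q 0 := by
    funext q
    rw [leftInvariantField_apply]
    rfl
  rw [e, h.fderiv, leftInvariantField_apply]
  change _ * coordVec k 0 = _
  rw [coordVec_apply, mul_comm]
  simp only [eq_comm]

/-- The quadratic term `g⁻¹ (w₀ g' w - (1 / 2) g'(w, w) e₁)` of the geodesic equation of a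
field `g` whose components depend on the first coordinate only, with derivative `g' = dg`. -/
theorem sum_christoffel {g : TensorField} {p : Psh} {dg : Matrix (Fin 3) (Fin 3) ℝ}
    (h : ∀ i j k, fderiv ℝ (fun q => g q i j) p (coordVec k) = (if k = 0 then 1 else 0) * dg i j)
    (hs : dg.IsSymm) (w : Fin 3 → ℝ) (k : Fin 3) :
    ∑ i, ∑ j, christoffel g p k i j * w i * w j
      = ((g p)⁻¹ *ᵥ (w 0 • (dg *ᵥ w) - ((1 / 2) * (w ⬝ᵥ dg *ᵥ w)) • ![1, 0, 0])) k := by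
  have h01 : dg 1 0 = dg 0 1 := hs.apply 0 1
  have h02 : dg 2 0 = dg 0 2 := hs.apply 0 2
  have h12 : dg 2 1 = dg 1 2 := hs.apply 1 2
  simp only [christoffel, h, Matrix.mulVec, dotProduct, Fin.sum_univ_three, Pi.sub_apply,
    Pi.smul_apply, smul_eq_mul]
  simp [h01, h02, h12]
  ring

/-- The geodesic equation of a left-invariant metric at a point `p`, for a curve with derivatives
`w` and `a`, in terms of the left translates of `w` and `a`. -/
theorem geodesic_equation_iff {Q : Matrix (Fin 3) (Fin 3) ℝ} (hQ : Q.IsSymm) (hdet : Q.det ≠ 0)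
    (p : Psh) (w a : Fin 3 → ℝ) :
    (∀ k, a k + ∑ i, ∑ j, christoffel (leftInvariantField Q) p k i j * w i * w j = 0) ↔
      Q *ᵥ (transMat (-p 0) *ᵥ a - w 0 • (adOne *ᵥ (transMat (-p 0) *ᵥ w)))
        = coad (transMat (-p 0) *ᵥ w) (Q *ᵥ (transMat (-p 0) *ᵥ w)) := by
  set J := transMat (-p 0) with hJ
  set v := J *ᵥ w with hv
  have hJinv : J * transMat (p 0) = 1 := transMat_neg_mul _
  have hJdet : J.det ≠ 0 := by
    intro h0
    have := congrArg Matrix.det hJinv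
    rw [Matrix.det_mul, h0] at this
    simp at this
  have hg : leftInvariantField Q p = Jᵀ * Q * J := leftInvariantField_apply Q p
  have hgdet : IsUnit (leftInvariantField Q p).det := by
    rw [hg, Matrix.det_mul, Matrix.det_mul, Matrix.det_transpose, isUnit_iff_ne_zero]
    exact mul_ne_zero (mul_ne_zero hJdet hdet) hJdet
  have hgs : (Jᵀ * Q * J)ᵀ = Jᵀ * Q * J := by
    rw [Matrix.transpose_mul, Matrix.transpose_mul, Matrix.transpose_transpose, hQ.eq,
      Matrix.mul_assoc]
  have hs : (-(adOneᵀ * leftInvariantField Q p + leftInvariantField Q p * adOne)).IsSymm := by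
    rw [hg, Matrix.IsSymm, Matrix.transpose_neg, Matrix.transpose_add,
      Matrix.transpose_mul adOneᵀ, Matrix.transpose_mul (Jᵀ * Q * J), hgs,
      Matrix.transpose_transpose, add_comm]
  have hcomm : ∀ x, J *ᵥ (adOne *ᵥ x) = adOne *ᵥ (J *ᵥ x) := by
    intro x
    rw [Matrix.mulVec_mulVec, Matrix.mulVec_mulVec, adOne_mul_transMat]
  have hcomm' : ∀ x, adOneᵀ *ᵥ (Jᵀ *ᵥ x) = Jᵀ *ᵥ (adOneᵀ *ᵥ x) := by
    intro x
    rw [Matrix.mulVec_mulVec, Matrix.mulVec_mulVec, ← Matrix.transpose_mul, ← Matrix.transpose_mul,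
      adOne_mul_transMat]
  have hJe : Jᵀ *ᵥ ![1, 0, 0] = ![1, 0, 0] := by
    ext i; fin_cases i <;> simp [hJ, transMat, Matrix.mulVec, dotProduct, Fin.sum_univ_three]
  have hw0 : v 0 = w 0 := by
    simp [hv, hJ, transMat, dotProduct, Fin.sum_univ_three]
  -- the derivative of the metric, applied to `w`
  have hdw : (-(adOneᵀ * leftInvariantField Q p + leftInvariantField Q p * adOne)) *ᵥ w
      = -(Jᵀ *ᵥ (adOneᵀ *ᵥ (Q *ᵥ v) + Q *ᵥ (adOne *ᵥ v))) := by
    rw [hg, Matrix.neg_mulVec, Matrix.add_mulVec, Matrix.mulVec_add]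
    simp only [← Matrix.mulVec_mulVec]
    rw [hcomm, hcomm']
  have hwd : w ⬝ᵥ (-(adOneᵀ * leftInvariantField Q p + leftInvariantField Q p * adOne)) *ᵥ w
      = -(2 * ((Q *ᵥ v) ⬝ᵥ (adOne *ᵥ v))) := by
    rw [hdw, dotProduct_neg, Matrix.mulVec_transpose, dotProduct_comm, ← Matrix.dotProduct_mulVec,
      ← hv, add_dotProduct, Matrix.mulVec_transpose, ← Matrix.dotProduct_mulVec]
    have : (Q *ᵥ (adOne *ᵥ v)) ⬝ᵥ v = (Q *ᵥ v) ⬝ᵥ (adOne *ᵥ v) := by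
      rw [dotProduct_comm, Matrix.dotProduct_mulVec, ← Matrix.mulVec_transpose, hQ.eq]
    rw [this]
    ring
  have hcoad : coad v (Q *ᵥ v) = v 0 • (adOneᵀ *ᵥ (Q *ᵥ v))
      - ((Q *ᵥ v) ⬝ᵥ (adOne *ᵥ v)) • ![1, 0, 0] := by
    generalize Q *ᵥ v = m
    ext i
    fin_cases i <;> simp [coad, adOne, Matrix.mulVec, dotProduct, Fin.sum_univ_three]
    ring
  have hJt : ∀ x, Jᵀ *ᵥ x = 0 ↔ x = 0 := by
    intro x
    refine ⟨fun hx => ?_, fun hx => by rw [hx, Matrix.mulVec_zero]⟩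
    have := congrArg ((transMat (p 0))ᵀ *ᵥ ·) hx
    simpa [Matrix.mulVec_mulVec, ← Matrix.transpose_mul, hJinv] using this
  have hgt : ∀ x, x = 0 ↔ leftInvariantField Q p *ᵥ x = 0 := by
    intro x
    refine ⟨fun hx => by rw [hx, Matrix.mulVec_zero], fun hx => ?_⟩
    have := congrArg ((leftInvariantField Q p)⁻¹ *ᵥ ·) hx
    simpa [Matrix.mulVec_mulVec, Matrix.nonsing_inv_mul _ hgdet] using this
  simp only [sum_christoffel
    (dg := -(adOneᵀ * leftInvariantField Q p + leftInvariantField Q p * adOne))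
    (fderiv_leftInvariantField Q p) hs]
  rw [hwd, hdw]
  have h1 : (∀ k, a k + ((leftInvariantField Q p)⁻¹ *ᵥ
      (w 0 • -(Jᵀ *ᵥ (adOneᵀ *ᵥ (Q *ᵥ v) + Q *ᵥ (adOne *ᵥ v)))
        - ((1 / 2) * -(2 * ((Q *ᵥ v) ⬝ᵥ (adOne *ᵥ v)))) • ![1, 0, 0])) k = 0) ↔
      a + (leftInvariantField Q p)⁻¹ *ᵥ
      (w 0 • -(Jᵀ *ᵥ (adOneᵀ *ᵥ (Q *ᵥ v) + Q *ᵥ (adOne *ᵥ v)))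
        - ((1 / 2) * -(2 * ((Q *ᵥ v) ⬝ᵥ (adOne *ᵥ v)))) • ![1, 0, 0]) = 0 :=
    ⟨fun h => funext h, fun h k => congrFun h k⟩
  rw [h1, hgt, Matrix.mulVec_add, Matrix.mulVec_mulVec, Matrix.mul_nonsing_inv _ hgdet,
    Matrix.one_mulVec, ← sub_eq_zero (b := coad _ _), hcoad, hw0, ← hJt (_ - _), hg]
  simp only [← Matrix.mulVec_mulVec, Matrix.mulVec_sub, Matrix.mulVec_add, Matrix.mulVec_smul,
    hJe]
  have e : ∀ x y z e : Fin 3 → ℝ, ∀ c d : ℝ,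
      x + (c • -(y + z) - (1 / 2 * -(2 * d)) • e) = x - c • z - (c • y - d • e) := by
    intro x y z e c d
    ext i
    simp
    ring
  rw [e]

/-! ### The Euler–Arnold equation -/


/-- The coordinate vector of a point, or of a tangent vector, of `Psh`. -/
def toVec (p : Psh) : Fin 3 → ℝ := fun i => p i

theorem toVec_apply (p : Psh) (i : Fin 3) : toVec p i = p i := rfl

theorem toVec_injective : Function.Injective toVec := fun _ _ h => h

theorem velocity_eq (γ : ℝ → Psh) (t : ℝ) :
    toVec (velocity γ t) = transMat (-γ t 0) *ᵥ toVec (deriv γ t) := by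
  funext i
  rw [velocity, (hasFDerivAt_mul_left _ _).fderiv, inv_apply_zero, toVec_apply, matCLM_apply]
  simp only [← toVec_apply]
  simp [Matrix.mulVec, dotProduct, Fin.sum_univ_three]

theorem hasDerivAt_mulVec {Q : Matrix (Fin 3) (Fin 3) ℝ} {v : ℝ → Fin 3 → ℝ} {w : Fin 3 → ℝ} {t : ℝ}
    (h : HasDerivAt v w t) : HasDerivAt (fun s => Q *ᵥ v s) (Q *ᵥ w) t := by
  rw [hasDerivAt_pi] at h ⊢
  intro i
  exact HasDerivAt.fun_sum (u := Finset.univ) fun j _ => (h j).const_mul (Q i j)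

/-- The derivative of the left-translated velocity. -/
theorem hasDerivAt_velocity {γ : ℝ → Psh} (hγ : ContDiff ℝ 2 γ) (t : ℝ) :
    HasDerivAt (fun s => toVec (velocity γ s))
      (transMat (-γ t 0) *ᵥ toVec (deriv (deriv γ) t)
        - toVec (deriv γ t) 0 • (adOne *ᵥ (transMat (-γ t 0) *ᵥ toVec (deriv γ t)))) t := by
  have hd : ∀ i, HasDerivAt (fun s => γ s i) (toVec (deriv γ t) i) t :=
    hasDerivAt_iff.1 ((hγ.differentiable two_ne_zero) t).hasDerivAt
  have hγ' : ContDiff ℝ 1 (deriv γ) := hγ.iterate_deriv' 1 1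
  have hd' : ∀ i, HasDerivAt (fun s => toVec (deriv γ s) i) (toVec (deriv (deriv γ) t) i) t :=
    hasDerivAt_iff.1 ((hγ'.differentiable one_ne_zero) t).hasDerivAt
  rw [hasDerivAt_pi]
  intro i
  simp only [velocity_eq]
  have h : HasDerivAt (fun s => ∑ j, transMat (-γ s 0) i j * toVec (deriv γ s) j)
      (∑ j, ((-(adOne * transMat (-γ t 0)) i j * toVec (deriv γ t) 0) * toVec (deriv γ t) j
        + transMat (-γ t 0) i j * toVec (deriv (deriv γ) t) j)) t :=
    HasDerivAt.fun_sum fun j _ => HasDerivAt.fun_mul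
      (HasDerivAt.comp t (h₂ := fun s => transMat (-s) i j) (hasDerivAt_transMat_neg (γ t 0) i j)
        (hd 0)) (hd' j)
  refine HasDerivAt.congr_deriv h ?_
  rw [Matrix.mulVec_mulVec, Finset.sum_add_distrib]
  simp only [Pi.sub_apply, Pi.smul_apply, smul_eq_mul, Matrix.mulVec, dotProduct, Finset.mul_sum]
  rw [sub_eq_add_neg, add_comm, ← Finset.sum_neg_distrib]
  congr 1
  exact Finset.sum_congr rfl fun j _ => by ring

/-- Geodesics are the curves whose left-translated velocity solves the Euler–Arnold equation. -/
theorem isGeodesic_iff {Q : Matrix (Fin 3) (Fin 3) ℝ} (hQ : Q.IsSymm) (hdet : Q.det ≠ 0)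
    {γ : ℝ → Psh} : IsGeodesic (leftInvariantField Q) γ ↔
      ContDiff ℝ 2 γ ∧ IsEulerArnold Q (fun t => toVec (velocity γ t)) := by
  refine and_congr_right fun hγ => forall_congr' fun t => ?_
  have h := hasDerivAt_mulVec (Q := Q) (hasDerivAt_velocity hγ t)
  refine (geodesic_equation_iff hQ hdet (γ t) (toVec (deriv γ t))
    (toVec (deriv (deriv γ) t))).trans ?_
  rw [← velocity_eq] at h ⊢
  exact ⟨fun e => e ▸ h, fun h' => h.unique h'⟩

theorem contDiff_two_of_hasDerivAt {f f' : ℝ → ℝ} (h : ∀ t, HasDerivAt f (f' t) t)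
    (h' : ContDiff ℝ 1 f') : ContDiff ℝ 2 f := by
  rw [show (2 : WithTop ℕ∞) = 1 + 1 from by norm_num, contDiff_succ_iff_deriv]
  refine ⟨fun t => (h t).differentiableAt, by simp, ?_⟩
  rwa [show deriv f = f' from funext fun t => (h t).deriv]

/-- Every `C¹` curve in the Lie algebra is the left-translated velocity of a curve in `Psh` with a
prescribed initial point. -/
theorem exists_velocity_eq {v : ℝ → Fin 3 → ℝ} (hv : ContDiff ℝ 1 v) (p : Psh) :
    ∃ γ : ℝ → Psh, ContDiff ℝ 2 γ ∧ γ 0 = p ∧ ∀ t, toVec (velocity γ t) = v t := by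
  have hv' : ∀ i, ContDiff ℝ 1 fun t => v t i := contDiff_pi.1 hv
  have prim : ∀ {f : ℝ → ℝ} (c : ℝ), ContDiff ℝ 1 f →
      ∃ F : ℝ → ℝ, F 0 = c ∧ ContDiff ℝ 2 F ∧ ∀ t, HasDerivAt F (f t) t := by
    intro f c hf
    have h : ∀ t, HasDerivAt (fun t => c + ∫ s in (0 : ℝ)..t, f s) (f t) t := fun t =>
      (intervalIntegral.integral_hasDerivAt_right (hf.continuous.intervalIntegrable _ _)
        (hf.continuous.stronglyMeasurableAtFilter _ _) hf.continuous.continuousAt).const_add c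
    exact ⟨_, by simp, contDiff_two_of_hasDerivAt h hf, h⟩
  obtain ⟨T, T0, hT, hT'⟩ := prim (p 0) (hv' 0)
  have hT1 : ContDiff ℝ 1 T := hT.of_le (by norm_num)
  obtain ⟨z, z0, hz, hz'⟩ := prim (p 2) (hT1.exp.mul (hv' 2))
  obtain ⟨y, y0, hy, hy'⟩ := prim (p 1) (hT1.exp.mul ((hv' 1).add (hT1.mul (hv' 2))))
  refine ⟨fun t => mk (T t) ![y t, z t], ?_, ?_, ?_⟩
  · rw [contDiff_iff]
    intro i
    fin_cases i
    exacts [hT, hy, hz]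
  · exact ext T0 y0 z0
  · intro t
    have hd : deriv (fun t => mk (T t) ![y t, z t]) t
        = mk (v t 0) ![Real.exp (T t) * (v t 1 + T t * v t 2), Real.exp (T t) * v t 2] := by
      apply HasDerivAt.deriv
      rw [hasDerivAt_iff]
      intro i
      fin_cases i
      exacts [hT' t, hy' t, hz' t]
    rw [velocity_eq, hd]
    have e : Real.exp (-T t) * Real.exp (T t) = 1 := by rw [← Real.exp_add]; simp
    funext i
    change (transMat (-T t) *ᵥ ![v t 0, Real.exp (T t) * (v t 1 + T t * v t 2),
      Real.exp (T t) * v t 2]) i = v t i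
    fin_cases i
    · simp [transMat, Matrix.mulVec, dotProduct, Fin.sum_univ_three]
    · simp [transMat, Matrix.mulVec, dotProduct, Fin.sum_univ_three]
      linear_combination (v t 1) * e
    · simp [transMat, Matrix.mulVec, dotProduct, Fin.sum_univ_three]
      linear_combination (v t 2) * e

theorem IsEulerArnold.contDiff {Q : Matrix (Fin 3) (Fin 3) ℝ} (hdet : Q.det ≠ 0)
    {v : ℝ → Fin 3 → ℝ} (h : IsEulerArnold Q v) : ContDiff ℝ 1 v := by
  have hd : ∀ t, HasDerivAt v (Q⁻¹ *ᵥ coad (v t) (Q *ᵥ v t)) t := by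
    intro t
    have := hasDerivAt_mulVec (Q := Q⁻¹) (h t)
    simpa [Matrix.mulVec_mulVec, Matrix.nonsing_inv_mul _ (isUnit_iff_ne_zero.2 hdet)] using this
  have hc : Continuous v := continuous_iff_continuousAt.2 fun t => (hd t).continuousAt
  rw [contDiff_one_iff_deriv]
  refine ⟨fun t => (hd t).differentiableAt, ?_⟩
  rw [show deriv v = fun t => Q⁻¹ *ᵥ coad (v t) (Q *ᵥ v t) from funext fun t => (hd t).deriv]
  have hm : Continuous fun t => Q *ᵥ v t := continuous_const.matrix_mulVec hc
  refine continuous_const.matrix_mulVec (continuous_pi fun i => ?_)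
  have hv' := continuous_pi_iff.1 hc
  have hm' := continuous_pi_iff.1 hm
  fin_cases i
  · exact ((((hv' 1).add (hv' 2)).neg.mul (hm' 1)).sub ((hv' 2).mul (hm' 2)))
  · exact (hv' 0).mul (hm' 1)
  · exact (hv' 0).mul ((hm' 1).add (hm' 2))

/-- The Euler–Arnold equation of `Q` has a global solution for every initial value. -/
def EulerArnoldComplete (Q : Matrix (Fin 3) (Fin 3) ℝ) : Prop :=
  ∀ v₀ : Fin 3 → ℝ, ∃ v, IsEulerArnold Q v ∧ v 0 = v₀

/-- All global solutions of the Euler–Arnold equation of `Q` are bounded. -/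
def EulerArnoldBounded (Q : Matrix (Fin 3) (Fin 3) ℝ) : Prop :=
  ∀ v, IsEulerArnold Q v → ∃ M : ℝ, ∀ t, ‖v t‖ ≤ M

theorem isComplete_iff {Q : Matrix (Fin 3) (Fin 3) ℝ} (hQ : Q.IsSymm) (hdet : Q.det ≠ 0) :
    IsComplete (leftInvariantField Q) ↔ EulerArnoldComplete Q := by
  constructor
  · intro h v₀
    obtain ⟨γ, hγ, h0, h1⟩ := h 1 (mk (v₀ 0) ![v₀ 1, v₀ 2])
    refine ⟨_, ((isGeodesic_iff hQ hdet).1 hγ).2, ?_⟩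
    simp only [velocity_eq, h0, h1, one_apply, neg_zero, transMat_zero, Matrix.one_mulVec]
    funext i
    fin_cases i <;> rfl
  · intro h p w
    obtain ⟨v, hv, h0⟩ := h (transMat (-p 0) *ᵥ toVec w)
    obtain ⟨γ, hγ, hp, hγv⟩ := exists_velocity_eq (hv.contDiff hdet) p
    refine ⟨γ, (isGeodesic_iff hQ hdet).2 ⟨hγ, (funext hγv).symm ▸ hv⟩, hp, toVec_injective ?_⟩
    have := hγv 0
    rw [h0, velocity_eq, hp] at this
    have := congrArg (transMat (p 0) *ᵥ ·) this
    simpa [Matrix.mulVec_mulVec, transMat_mul_neg] using this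

theorem forall_hasBoundedVelocity_iff {Q : Matrix (Fin 3) (Fin 3) ℝ} (hQ : Q.IsSymm)
    (hdet : Q.det ≠ 0) :
    (∀ γ, IsGeodesic (leftInvariantField Q) γ → HasBoundedVelocity γ) ↔
      EulerArnoldBounded Q := by
  constructor
  · intro h v hv
    obtain ⟨γ, hγ, -, hγv⟩ := exists_velocity_eq (hv.contDiff hdet) 1
    obtain ⟨M, hM⟩ := h γ ((isGeodesic_iff hQ hdet).2 ⟨hγ, (funext hγv).symm ▸ hv⟩)
    refine ⟨M, fun t => ?_⟩
    rw [← hγv]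
    exact hM t
  · intro h γ hγ
    obtain ⟨M, hM⟩ := h _ ((isGeodesic_iff hQ hdet).1 hγ).2
    exact ⟨M, hM⟩

/-! ### Change of basis -/

/-- `autMat p q a b` is an automorphism of the Lie algebra, stated for the coadjoint action. -/
theorem autMat_transpose_mulVec_coad (p q a b : ℝ) (v m : Fin 3 → ℝ) :
    (autMat p q a b)ᵀ *ᵥ coad (autMat p q a b *ᵥ v) m = coad v ((autMat p q a b)ᵀ *ᵥ m) := by
  ext i
  fin_cases i <;>
    simp [autMat, coad, Matrix.mulVec, dotProduct, Fin.sum_univ_three] <;> ring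

theorem isUnit_det_autMat {a : ℝ} (ha : a ≠ 0) (p q b : ℝ) : IsUnit (autMat p q a b).det := by
  rw [isUnit_iff_ne_zero, Matrix.det_fin_three]
  simp [autMat, ha]

/-- Automorphisms map solutions of the Euler–Arnold equation to solutions. -/
theorem isEulerArnold_autMat_iff {N Q : Matrix (Fin 3) (Fin 3) ℝ} {p q a b c : ℝ} (ha : a ≠ 0)
    (hc : c ≠ 0) (h : (autMat p q a b)ᵀ * N * autMat p q a b = c • Q) {v : ℝ → Fin 3 → ℝ} :
    IsEulerArnold N (fun t => autMat p q a b *ᵥ v t) ↔ IsEulerArnold Q v := by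
  set A := autMat p q a b with hA
  have hAu : IsUnit Aᵀ.det := by rw [Matrix.det_transpose]; exact isUnit_det_autMat ha p q b
  have hm : ∀ x, Aᵀ *ᵥ (N *ᵥ (A *ᵥ x)) = c • (Q *ᵥ x) := by
    intro x
    rw [Matrix.mulVec_mulVec, Matrix.mulVec_mulVec, h, Matrix.smul_mulVec]
  have hsmul : ∀ x m, coad x (c • m) = c • coad x m := by
    intro x m
    ext i
    fin_cases i <;> simp [coad] <;> ring
  have hcoad : ∀ x, Aᵀ *ᵥ coad (A *ᵥ x) (N *ᵥ (A *ᵥ x)) = c • coad x (Q *ᵥ x) := by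
    intro x
    rw [hA, autMat_transpose_mulVec_coad, ← hA, hm, hsmul]
  constructor
  · intro hv t
    have := (hasDerivAt_mulVec (Q := Aᵀ) (hv t)).fun_const_smul c⁻¹
    simpa only [hm, hcoad, smul_smul, inv_mul_cancel₀ hc, one_smul] using this
  · intro hv t
    have := hasDerivAt_mulVec (Q := (Aᵀ)⁻¹) ((hv t).fun_const_smul c)
    simp only [← hcoad, ← hm] at this
    have e : ∀ x, (Aᵀ)⁻¹ *ᵥ (Aᵀ *ᵥ x) = x := fun x => by
      rw [Matrix.mulVec_mulVec, Matrix.nonsing_inv_mul _ hAu, Matrix.one_mulVec]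
    simpa only [e] using this

theorem eulerArnoldComplete_iff {N Q : Matrix (Fin 3) (Fin 3) ℝ} {p q a b c : ℝ} (ha : a ≠ 0)
    (hc : c ≠ 0) (h : (autMat p q a b)ᵀ * N * autMat p q a b = c • Q) :
    EulerArnoldComplete N ↔ EulerArnoldComplete Q := by
  have hu := isUnit_det_autMat ha p q b
  have e : ∀ x, (autMat p q a b)⁻¹ *ᵥ (autMat p q a b *ᵥ x) = x := fun x => by
    rw [Matrix.mulVec_mulVec, Matrix.nonsing_inv_mul _ hu, Matrix.one_mulVec]
  have e' : ∀ x, autMat p q a b *ᵥ ((autMat p q a b)⁻¹ *ᵥ x) = x := fun x => by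
    rw [Matrix.mulVec_mulVec, Matrix.mul_nonsing_inv _ hu, Matrix.one_mulVec]
  constructor
  · intro hN v₀
    obtain ⟨v, hv, h0⟩ := hN (autMat p q a b *ᵥ v₀)
    refine ⟨fun t => (autMat p q a b)⁻¹ *ᵥ v t, ?_, by simp only [h0, e]⟩
    rw [← isEulerArnold_autMat_iff ha hc h]
    simpa only [e'] using hv
  · intro hQ v₀
    obtain ⟨v, hv, h0⟩ := hQ ((autMat p q a b)⁻¹ *ᵥ v₀)
    exact ⟨_, (isEulerArnold_autMat_iff ha hc h).2 hv, by simp only [h0, e']⟩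

theorem exists_norm_mulVec_le (A : Matrix (Fin 3) (Fin 3) ℝ) {v : ℝ → Fin 3 → ℝ}
    (h : ∃ M : ℝ, ∀ t, ‖v t‖ ≤ M) : ∃ M : ℝ, ∀ t, ‖A *ᵥ v t‖ ≤ M := by
  obtain ⟨M, hM⟩ := h
  let L := LinearMap.toContinuousLinearMap (𝕜 := ℝ) A.mulVecLin
  exact ⟨‖L‖ * M, fun t => (L.le_opNorm (v t)).trans (by gcongr; exact hM t)⟩

theorem eulerArnoldBounded_iff {N Q : Matrix (Fin 3) (Fin 3) ℝ} {p q a b c : ℝ} (ha : a ≠ 0)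
    (hc : c ≠ 0) (h : (autMat p q a b)ᵀ * N * autMat p q a b = c • Q) :
    EulerArnoldBounded N ↔ EulerArnoldBounded Q := by
  have hu := isUnit_det_autMat ha p q b
  have e : ∀ x, (autMat p q a b)⁻¹ *ᵥ (autMat p q a b *ᵥ x) = x := fun x => by
    rw [Matrix.mulVec_mulVec, Matrix.nonsing_inv_mul _ hu, Matrix.one_mulVec]
  have e' : ∀ x, autMat p q a b *ᵥ ((autMat p q a b)⁻¹ *ᵥ x) = x := fun x => by
    rw [Matrix.mulVec_mulVec, Matrix.mul_nonsing_inv _ hu, Matrix.one_mulVec]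
  constructor
  · intro hN v hv
    have := exists_norm_mulVec_le (autMat p q a b)⁻¹
      (hN _ ((isEulerArnold_autMat_iff ha hc h).2 hv))
    simpa only [e] using this
  · intro hQ v hv
    have hw : IsEulerArnold Q fun t => (autMat p q a b)⁻¹ *ᵥ v t := by
      rw [← isEulerArnold_autMat_iff ha hc h]
      simpa only [e'] using hv
    simpa only [e'] using exists_norm_mulVec_le (autMat p q a b) (hQ _ hw)

/-! ### Global solutions of Newton's equation -/


/-- A compactly supported `C¹` vector field has integral curves on arbitrarily long intervals. -/
theorem exists_integralCurve_of_hasCompactSupport {E : Type*} [NormedAddCommGroup E]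
    [NormedSpace ℝ E] [CompleteSpace E] {f : E → E} (hf : ContDiff ℝ 1 f)
    (hs : HasCompactSupport f) (x₀ : E) {a : ℝ} (ha : 0 < a) :
    ∃ γ : ℝ → E, γ 0 = x₀ ∧ ∀ t ∈ Set.Ioo (-a) a, HasDerivAt γ (f (γ t)) t := by
  obtain ⟨K, hK⟩ := hf.lipschitzWith_of_hasCompactSupport hs one_ne_zero
  obtain ⟨L, hL⟩ := hf.continuous.bounded_above_of_compact_support hs
  have hL0 : 0 ≤ L := (norm_nonneg _).trans (hL x₀)
  have hP : IsPicardLindelof (fun _ => f) (tmin := -a) (tmax := a) ⟨0, by simp [ha.le]⟩ x₀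
      ⟨L * a, mul_nonneg hL0 ha.le⟩ 0 ⟨L, hL0⟩ K :=
    { lipschitzOnWith := fun _ _ => hK.lipschitzOnWith
      continuousOn := fun _ _ => continuousOn_const
      norm_le := fun _ _ x _ => hL x
      mul_max_le := by
        simp only [sub_zero, zero_sub, neg_neg, max_self, NNReal.coe_zero]
        exact le_rfl }
  obtain ⟨γ, h0, h⟩ := hP.exists_eq_forall_mem_Icc_hasDerivWithinAt₀
  exact ⟨γ, h0, fun t ht => (h t (Set.Ioo_subset_Icc_self ht)).hasDerivAt (Icc_mem_nhds ht.1 ht.2)⟩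

/-- Integral curves of a `C¹` vector field on the intervals `(-a, a)` glue to a global one. -/
theorem exists_integralCurve_of_forall_Ioo {E : Type*} [NormedAddCommGroup E]
    [NormedSpace ℝ E] [CompleteSpace E] {f : E → E} (hf : ContDiff ℝ 1 f) (x₀ : E)
    (h : ∀ a : ℝ, 0 < a → ∃ γ : ℝ → E, γ 0 = x₀ ∧
      ∀ t ∈ Set.Ioo (-a) a, HasDerivAt γ (f (γ t)) t) :
    ∃ γ : ℝ → E, γ 0 = x₀ ∧ ∀ t, HasDerivAt γ (f (γ t)) t := by
  have key := (exists_isMIntegralCurve_iff_exists_isMIntegralCurveOn_Ioo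
    (I := modelWithCornersSelf ℝ E) (M := E) (v := f)
    (contMDiff_vectorSpace_iff_contDiff.2 hf) x₀).2 ?_
  · obtain ⟨γ, h0, hγ⟩ := key
    refine ⟨γ, h0, fun t => ?_⟩
    have ht : HasFDerivAt γ ((1 : ℝ →L[ℝ] ℝ).smulRight (f (γ t))) t :=
      hasMFDerivAt_iff_hasFDerivAt.1 (hγ t)
    simpa using ht.hasDerivAt
  · intro a
    obtain ⟨γ, h0, hγ⟩ := h (|a| + 1) (by positivity)
    refine ⟨γ, h0, fun t ht => ?_⟩
    have hle := le_abs_self a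
    have := hγ t ⟨by linarith [ht.1], by linarith [ht.2]⟩
    exact hasMFDerivWithinAt_iff_hasFDerivWithinAt.2 this.hasFDerivAt.hasFDerivWithinAt

/-- Newton's equation `T'' = -V'(T) / 2` on the line is complete if the potential `V` is bounded
below. -/
theorem exists_newton_solution {V V' : ℝ → ℝ} (hV : ∀ x, HasDerivAt V (V' x) x)
    (hV' : ContDiff ℝ 1 V') {K : ℝ} (hK : ∀ x, -K ≤ V x) (T₀ x₀ : ℝ) :
    ∃ T x : ℝ → ℝ, T 0 = T₀ ∧ x 0 = x₀ ∧ (∀ t, HasDerivAt T (x t) t) ∧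
      ∀ t, HasDerivAt x (-(1 / 2) * V' (T t)) t := by
  have hproj {γ : ℝ → ℝ × ℝ} {w : ℝ × ℝ} {t : ℝ} (h : HasDerivAt γ w t) :
      HasDerivAt (fun s => (γ s).1) w.1 t ∧ HasDerivAt (fun s => (γ s).2) w.2 t := by
    constructor
    · exact (ContinuousLinearMap.fst ℝ ℝ ℝ).hasFDerivAt.comp_hasDerivAt t h
    · exact (ContinuousLinearMap.snd ℝ ℝ ℝ).hasFDerivAt.comp_hasDerivAt t h
  let f : ℝ × ℝ → ℝ × ℝ := fun q => (q.2, -(1 / 2) * V' q.1)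
  have hf : ContDiff ℝ 1 f := contDiff_snd.prodMk (contDiff_const.mul (hV'.comp contDiff_fst))
  obtain ⟨γ, h0, hγ⟩ := exists_integralCurve_of_forall_Ioo hf (T₀, x₀) fun a ha => by
    -- On `(-a, a)` the energy confines the solution to the ball of radius `R`. Multiplying the
    -- field by a bump function does not affect conservation of energy along solutions.
    let B := √(x₀ ^ 2 + V T₀ + K)
    let R := |T₀| + B * a + B + 1
    have hB : 0 ≤ B := Real.sqrt_nonneg _
    have hR : 0 < R := by positivity
    let ψ : ContDiffBump (0 : ℝ × ℝ) := ⟨R, R + 1, hR, by linarith⟩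
    obtain ⟨γ, h0, hγ⟩ := exists_integralCurve_of_hasCompactSupport
      (f := fun q => ψ q • f q) (ψ.contDiff.smul hf) ψ.hasCompactSupport.smul_right (T₀, x₀) ha
    refine ⟨γ, h0, fun t ht => ?_⟩
    have h0mem : (0 : ℝ) ∈ Set.Ioo (-a) a := ⟨by linarith, ha⟩
    have hconst : ∀ s ∈ Set.Ioo (-a) a, (γ s).2 ^ 2 + V (γ s).1 = x₀ ^ 2 + V T₀ := by
      intro s hs
      have hd : ∀ s ∈ Set.Ioo (-a) a, HasDerivAt (fun s => (γ s).2 ^ 2 + V (γ s).1) 0 s := by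
        intro s hs
        obtain ⟨h1, h2⟩ := hproj (hγ s hs)
        refine ((h2.pow 2).add ((hV _).comp s h1)).congr_deriv ?_
        simp [f]
        ring
      have := (convex_Ioo (-a) a).is_const_of_fderivWithin_eq_zero (𝕜 := ℝ)
        (f := fun s => (γ s).2 ^ 2 + V (γ s).1)
        (fun s hs => (hd s hs).differentiableAt.differentiableWithinAt)
        (fun s hs => by
          rw [fderivWithin_of_isOpen isOpen_Ioo hs]
          ext
          simpa using (hd s hs).deriv) hs h0mem
      simpa [h0] using this
    have hx : ∀ s ∈ Set.Ioo (-a) a, |(γ s).2| ≤ B := fun s hs =>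
      Real.abs_le_sqrt (by linarith [hconst s hs, hK (γ s).1])
    have hT : |(γ t).1| ≤ |T₀| + B * a := by
      have := (convex_Ioo (-a) a).norm_image_sub_le_of_norm_hasDerivWithin_le
        (f := fun s => (γ s).1) (C := B)
        (fun s hs => (hproj (hγ s hs)).1.hasDerivWithinAt)
        (fun s hs => by
          change ‖ψ (γ s) * (γ s).2‖ ≤ B
          rw [norm_mul, Real.norm_of_nonneg ψ.nonneg]
          exact (mul_le_of_le_one_left (norm_nonneg _) ψ.le_one).trans (hx s hs)) h0mem ht
      rw [h0, sub_zero, Real.norm_eq_abs, Real.norm_eq_abs] at this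
      have h1 := abs_sub_abs_le_abs_sub (γ t).1 T₀
      have h2 : B * |t| ≤ B * a := mul_le_mul_of_nonneg_left (abs_lt.2 ht).le hB
      linarith
    have hmem : γ t ∈ Metric.closedBall (0 : ℝ × ℝ) R := by
      rw [mem_closedBall_zero_iff, Prod.norm_def, max_le_iff, Real.norm_eq_abs, Real.norm_eq_abs]
      have := mul_nonneg hB ha.le
      exact ⟨by linarith, by linarith [hx t ht, abs_nonneg T₀]⟩
    have h1 : ψ (γ t) = 1 := ψ.one_of_mem_closedBall hmem
    simpa [h1] using hγ t ht
  exact ⟨fun t => (γ t).1, fun t => (γ t).2, by simp only [h0], by simp only [h0],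
    fun t => (hproj (hγ t)).1, fun t => (hproj (hγ t)).2⟩


/-! ### Complete metrics -/

theorem mulVec_fin_three (Q : Matrix (Fin 3) (Fin 3) ℝ) (v : Fin 3 → ℝ) (i : Fin 3) :
    (Q *ᵥ v) i = Q i 0 * v 0 + Q i 1 * v 1 + Q i 2 * v 2 := by
  simp [Matrix.mulVec, dotProduct, Fin.sum_univ_three]

theorem isEulerArnold_iff {Q : Matrix (Fin 3) (Fin 3) ℝ} {v : ℝ → Fin 3 → ℝ} :
    IsEulerArnold Q v ↔
      (∀ t, HasDerivAt (fun s => (Q *ᵥ v s) 0)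
        (-(v t 1 + v t 2) * (Q *ᵥ v t) 1 - v t 2 * (Q *ᵥ v t) 2) t) ∧
      (∀ t, HasDerivAt (fun s => (Q *ᵥ v s) 1) (v t 0 * (Q *ᵥ v t) 1) t) ∧
      ∀ t, HasDerivAt (fun s => (Q *ᵥ v s) 2) (v t 0 * ((Q *ᵥ v t) 1 + (Q *ᵥ v t) 2)) t := by
  simp only [← forall_and]
  refine forall_congr' fun t => ?_
  rw [hasDerivAt_pi]
  constructor
  · intro h
    exact ⟨h 0, h 1, h 2⟩
  · rintro ⟨h0, h1, h2⟩ i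
    fin_cases i
    exacts [h0, h1, h2]

/-- Let `α, β, δ` be the entries of the inverse of the restriction of the metric to the plane
spanned by `e₂, e₃`, which is orthogonal to the unit vector `e₁`. Along a solution, the momenta of
the translations of `ℝ²` are constants `c₁, c₂`, so that the `ℝ`-coordinate obeys Newton's equation
for the potential below. The metric is complete if these potentials are bounded below. -/
theorem eulerArnoldComplete_of_potential {a b d α β δ : ℝ} (h₁₁ : a * α + b * β = 1)
    (h₁₂ : a * β + b * δ = 0) (h₂₁ : b * α + d * β = 0) (h₂₂ : b * β + d * δ = 1)
    (hV : ∀ c₁ c₂ : ℝ, ∃ K, ∀ T : ℝ, -K ≤ Real.exp T ^ 2 *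
      (α * c₁ ^ 2 + 2 * β * c₁ * (c₂ + T * c₁) + δ * (c₂ + T * c₁) ^ 2)) :
    EulerArnoldComplete !![1, 0, 0; 0, a, b; 0, b, d] := by
  intro v₀
  set c₁ := a * v₀ 1 + b * v₀ 2 with hc₁
  set c₂ := b * v₀ 1 + d * v₀ 2 with hc₂
  obtain ⟨K, hK⟩ := hV c₁ c₂
  let V' : ℝ → ℝ := fun T => Real.exp T ^ 2 *
    (2 * (α * c₁ ^ 2 + 2 * β * c₁ * (c₂ + T * c₁) + δ * (c₂ + T * c₁) ^ 2)
      + 2 * β * c₁ * c₁ + 2 * δ * (c₂ + T * c₁) * c₁)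
  have hd : ∀ T, HasDerivAt (fun T : ℝ => Real.exp T ^ 2 *
      (α * c₁ ^ 2 + 2 * β * c₁ * (c₂ + T * c₁) + δ * (c₂ + T * c₁) ^ 2)) (V' T) T := by
    intro T
    have h1 : HasDerivAt (fun T : ℝ => c₂ + T * c₁) (1 * c₁) T :=
      ((hasDerivAt_id T).mul_const c₁).const_add c₂
    refine (((Real.hasDerivAt_exp T).fun_pow 2).fun_mul
      (((h1.const_mul (2 * β * c₁)).const_add (α * c₁ ^ 2)).fun_add
        ((h1.fun_pow 2).const_mul δ))).congr_deriv ?_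
    simp only [V']
    push_cast
    ring
  have hV' : ContDiff ℝ 1 V' := by fun_prop
  obtain ⟨T, x, hT0, hx0, hT, hx⟩ := exists_newton_solution hd hV' hK 0 (v₀ 0)
  let m₁ : ℝ → ℝ := fun t => Real.exp (T t) * c₁
  let m₂ : ℝ → ℝ := fun t => Real.exp (T t) * (c₂ + T t * c₁)
  let v : ℝ → Fin 3 → ℝ := fun t => ![x t, α * m₁ t + β * m₂ t, β * m₁ t + δ * m₂ t]
  have e0 : ∀ t, ((!![1, 0, 0; 0, a, b; 0, b, d] : Matrix (Fin 3) (Fin 3) ℝ) *ᵥ v t) 0 = x t := by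
    intro t; simp [mulVec_fin_three, v]
  have e1 : ∀ t, ((!![1, 0, 0; 0, a, b; 0, b, d] : Matrix (Fin 3) (Fin 3) ℝ) *ᵥ v t) 1 = m₁ t := by
    intro t; simp [mulVec_fin_three, v]
    linear_combination m₁ t * h₁₁ + m₂ t * h₁₂
  have e2 : ∀ t, ((!![1, 0, 0; 0, a, b; 0, b, d] : Matrix (Fin 3) (Fin 3) ℝ) *ᵥ v t) 2 = m₂ t := by
    intro t; simp [mulVec_fin_three, v]
    linear_combination m₁ t * h₂₁ + m₂ t * h₂₂
  refine ⟨v, isEulerArnold_iff.2 ?_, ?_⟩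
  · simp only [e0, e1, e2]
    refine ⟨fun t => (hx t).congr_deriv ?_, fun t => ?_, fun t => ?_⟩
    · simp [V', v, m₁, m₂]
      ring
    · refine ((hT t).exp.mul_const c₁).congr_deriv ?_
      simp [v, m₁]
      ring
    · refine ((hT t).exp.fun_mul (((hT t).mul_const c₁).const_add c₂)).congr_deriv ?_
      simp [v, m₁, m₂]
      ring
  · have ha1 : v₀ 1 = α * c₁ + β * c₂ := by
      linear_combination (-v₀ 1) * h₁₁ - v₀ 2 * h₂₁
    have ha2 : v₀ 2 = β * c₁ + δ * c₂ := by
      linear_combination (-v₀ 2) * h₂₂ - v₀ 1 * h₁₂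
    ext i
    fin_cases i <;> simp [v, m₁, m₂, hx0, hT0, ← ha1, ← ha2]

theorem eulerArnoldComplete_Q2 {s : ℝ} (hs : 0 < s) :
    EulerArnoldComplete !![1, 0, 0; 0, -1, 0; 0, 0, s] := by
  refine eulerArnoldComplete_of_potential (α := -1) (β := 0) (δ := s⁻¹) (by norm_num) (by norm_num)
    (by norm_num) (by field_simp; norm_num) fun c₁ c₂ => ?_
  -- the potential is nonnegative beyond `√s + |c₂ / c₁|`
  refine ⟨Real.exp (√s + |c₂ / c₁|) ^ 2 * c₁ ^ 2, fun T => ?_⟩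
  have hq : 0 ≤ Real.exp T ^ 2 * (s⁻¹ * (c₂ + T * c₁) ^ 2) := by positivity
  have hK : 0 ≤ Real.exp (√s + |c₂ / c₁|) ^ 2 * c₁ ^ 2 := by positivity
  by_cases hT : T ≤ √s + |c₂ / c₁|
  · have : Real.exp T ^ 2 * c₁ ^ 2 ≤ Real.exp (√s + |c₂ / c₁|) ^ 2 * c₁ ^ 2 := by gcongr
    linarith
  · have h : c₁ ^ 2 ≤ s⁻¹ * (c₂ + T * c₁) ^ 2 := by
      by_cases hc : c₁ = 0
      · rw [hc]; simp; positivity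
      · have h1 : √s ≤ T + c₂ / c₁ := by linarith [neg_abs_le (c₂ / c₁)]
        have h2 : s ≤ (T + c₂ / c₁) ^ 2 := by
          rw [← Real.sq_sqrt hs.le]
          exact pow_le_pow_left₀ (Real.sqrt_nonneg s) h1 2
        have h3 : (c₂ + T * c₁) ^ 2 = (T + c₂ / c₁) ^ 2 * c₁ ^ 2 := by field_simp; ring
        rw [h3, ← mul_assoc]
        refine le_mul_of_one_le_left (sq_nonneg _) ?_
        rw [inv_mul_eq_div, one_le_div hs]
        exact h2
    have := mul_le_mul_of_nonneg_left h (sq_nonneg (Real.exp T))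
    linarith

theorem eulerArnoldComplete_Q3 : EulerArnoldComplete !![1, 0, 0; 0, 0, 1; 0, 1, 0] := by
  refine eulerArnoldComplete_of_potential (α := 0) (β := 1) (δ := 0) (by norm_num) (by norm_num)
    (by norm_num) (by norm_num) fun c₁ c₂ => ?_
  -- the potential is `2 c₁ (c₂ + T c₁) exp (2 T)`
  refine ⟨Real.exp (-(c₂ / c₁)) ^ 2 * c₁ ^ 2, fun T => ?_⟩
  by_cases hc : c₁ = 0
  · simp [hc]
  · -- with `w = T + c₂ / c₁` the claim is `-1 ≤ 2 w exp (2 w)`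
    set w := T + c₂ / c₁ with hw
    have e1 : Real.exp T = Real.exp (-(c₂ / c₁)) * Real.exp w := by
      rw [← Real.exp_add, hw]; congr 1; ring
    have e2 : c₂ + T * c₁ = w * c₁ := by rw [hw]; field_simp; ring
    have h1 : -1 ≤ Real.exp w ^ 2 * (2 * w) := by
      rcases le_total 0 w with h | h
      · have : 0 ≤ Real.exp w ^ 2 * (2 * w) := by positivity
        linarith
      · have h2 : -(2 * w) ≤ Real.exp (-(2 * w)) := by
          linarith [Real.add_one_le_exp (-(2 * w))]
        have h3 : Real.exp w ^ 2 * Real.exp (-(2 * w)) = 1 := by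
          rw [← Real.exp_nat_mul, ← Real.exp_add]; simp
        have := mul_le_mul_of_nonneg_left h2 (sq_nonneg (Real.exp w))
        rw [h3] at this
        linarith
    have h2 := mul_le_mul_of_nonneg_left h1
      (by positivity : 0 ≤ Real.exp (-(c₂ / c₁)) ^ 2 * c₁ ^ 2)
    rw [e1, e2]
    linarith

/-- The momenta of the translations of `ℝ²` are conserved: in terms of a primitive `T` of the
component `v 0`, the last two components of the momentum are `exp T c₁` and `exp T (c₂ + T c₁)`. -/
theorem IsEulerArnold.exists_momentum {Q : Matrix (Fin 3) (Fin 3) ℝ} (hdet : Q.det ≠ 0)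
    {v : ℝ → Fin 3 → ℝ} (hv : IsEulerArnold Q v) :
    ∃ T : ℝ → ℝ, ∀ t, (Q *ᵥ v t) 1 = Real.exp (T t) * (Q *ᵥ v 0) 1 ∧
      (Q *ᵥ v t) 2 = Real.exp (T t) * ((Q *ᵥ v 0) 2 + T t * (Q *ᵥ v 0) 1) := by
  have hc : Continuous fun t => v t 0 := (contDiff_pi.1 (hv.contDiff hdet) 0).continuous
  let T : ℝ → ℝ := fun t => ∫ s in (0 : ℝ)..t, v s 0
  have hT : ∀ t, HasDerivAt T (v t 0) t := fun t =>
    intervalIntegral.integral_hasDerivAt_right (hc.intervalIntegrable _ _)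
      (hc.stronglyMeasurableAtFilter _ _) hc.continuousAt
  have hT0 : T 0 = 0 := by simp [T]
  obtain ⟨-, h1, h2⟩ := isEulerArnold_iff.1 hv
  have hE : ∀ t, HasDerivAt (fun s => Real.exp (-T s)) (Real.exp (-T t) * -v t 0) t := fun t =>
    (hT t).neg.exp
  have const {f : ℝ → ℝ} (hf : ∀ t, HasDerivAt f 0 t) (t : ℝ) : f t = f 0 :=
    is_const_of_deriv_eq_zero (fun t => (hf t).differentiableAt) (fun t => (hf t).deriv) t 0
  have k1 := const (f := fun t => Real.exp (-T t) * (Q *ᵥ v t) 1) fun t =>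
    ((hE t).fun_mul (h1 t)).congr_deriv (by ring)
  have k2 := const (f := fun t => Real.exp (-T t) * ((Q *ᵥ v t) 2 - T t * (Q *ᵥ v t) 1)) fun t =>
    ((hE t).fun_mul ((h2 t).fun_sub ((hT t).fun_mul (h1 t)))).congr_deriv (by ring)
  simp only [hT0, neg_zero, Real.exp_zero, one_mul, zero_mul, sub_zero] at k1 k2
  refine ⟨T, fun t => ?_⟩
  have e : Real.exp (T t) * Real.exp (-T t) = 1 := by rw [← Real.exp_add]; simp
  rw [← k1 t, ← k2 t]
  constructor
  · linear_combination (-(Q *ᵥ v t) 1) * e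
  · linear_combination (-(Q *ᵥ v t) 2) * e

theorem eulerArnoldBounded_Q2 {s : ℝ} (hs : 0 < s) :
    EulerArnoldBounded !![1, 0, 0; 0, -1, 0; 0, 0, s] := by
  intro v hv
  have hdet : (!![1, 0, 0; 0, -1, 0; 0, 0, s] : Matrix (Fin 3) (Fin 3) ℝ).det ≠ 0 := by
    simp [Matrix.det_fin_three, hs.ne']
  obtain ⟨T, hT⟩ := hv.exists_momentum hdet
  obtain ⟨h0, h1, h2⟩ := isEulerArnold_iff.1 hv
  simp [mulVec_fin_three] at h0 h1 h2 hT
  have hE : ∀ t, v t 0 ^ 2 - v t 1 ^ 2 + s⁻¹ * (s * v t 2) ^ 2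
      = v 0 0 ^ 2 - v 0 1 ^ 2 + s⁻¹ * (s * v 0 2) ^ 2 := by
    intro t
    have hd : ∀ t, HasDerivAt (fun t => v t 0 ^ 2 - (-v t 1) ^ 2 + s⁻¹ * (s * v t 2) ^ 2) 0 t := by
      intro t
      refine ((((h0 t).fun_pow 2).fun_sub ((h1 t).fun_pow 2)).fun_add
        (((h2 t).fun_pow 2).const_mul s⁻¹)).congr_deriv ?_
      push_cast
      field_simp
      ring
    simpa using is_const_of_deriv_eq_zero (fun t => (hd t).differentiableAt)
      (fun t => (hd t).deriv) t 0
  set E := v 0 0 ^ 2 - v 0 1 ^ 2 + s⁻¹ * (s * v 0 2) ^ 2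
  -- the `e₂`-momentum is bounded: unless it vanishes, the potential tends to infinity
  obtain ⟨M, hM⟩ : ∃ M, ∀ t, v t 1 ^ 2 ≤ M := by
    by_cases hc : v 0 1 = 0
    · refine ⟨0, fun t => ?_⟩
      have := (hT t).1
      rw [hc, mul_zero] at this
      rw [this]; simp
    · refine ⟨max (Real.exp (√(2 * s) + |s * v 0 2 / v 0 1|) ^ 2 * v 0 1 ^ 2) E, fun t => ?_⟩
      by_cases hTt : T t ≤ √(2 * s) + |s * v 0 2 / v 0 1|
      · refine le_max_of_le_left ?_
        rw [(hT t).1, mul_pow]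
        gcongr
      · refine le_max_of_le_right ?_
        have h3 : 2 * v t 1 ^ 2 ≤ s⁻¹ * (s * v t 2) ^ 2 := by
          rw [(hT t).1, (hT t).2]
          have h1 : √(2 * s) ≤ T t - s * v 0 2 / v 0 1 := by
            linarith [le_abs_self (s * v 0 2 / v 0 1)]
          have h2 : 2 * s ≤ (T t - s * v 0 2 / v 0 1) ^ 2 := by
            rw [← Real.sq_sqrt (by positivity : 0 ≤ 2 * s)]
            exact pow_le_pow_left₀ (Real.sqrt_nonneg _) h1 2
          have h3 : s⁻¹ * (Real.exp (T t) * (s * v 0 2 + -(T t * v 0 1))) ^ 2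
              = s⁻¹ * (T t - s * v 0 2 / v 0 1) ^ 2 * (Real.exp (T t) * v 0 1) ^ 2 := by
            field_simp
            ring
          rw [h3]
          refine mul_le_mul_of_nonneg_right ?_ (sq_nonneg _)
          rw [inv_mul_eq_div, le_div_iff₀ hs]
          exact h2
        linarith [hE t, sq_nonneg (v t 0)]
  have hq : ∀ t, 0 ≤ s⁻¹ * (s * v t 2) ^ 2 := fun t => by positivity
  have hz : ∀ t, s⁻¹ * (s * v t 2) ^ 2 = s * v t 2 ^ 2 := fun t => by field_simp
  refine ⟨√(max M (max (E + M) (s⁻¹ * (E + M)))), fun t => ?_⟩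
  rw [pi_norm_le_iff_of_nonneg (Real.sqrt_nonneg _)]
  intro i
  refine Real.abs_le_sqrt ?_
  fin_cases i
  · exact le_max_of_le_right (le_max_of_le_left (by
      change v t 0 ^ 2 ≤ _
      linarith [hE t, hM t, hq t]))
  · exact le_max_of_le_left (hM t)
  · refine le_max_of_le_right (le_max_of_le_right ?_)
    change v t 2 ^ 2 ≤ _
    rw [inv_mul_eq_div, le_div_iff₀ hs]
    linarith [hE t, hM t, hz t, sq_nonneg (v t 0)]

theorem not_eulerArnoldBounded_Q3 : ¬ EulerArnoldBounded !![1, 0, 0; 0, 0, 1; 0, 1, 0] := by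
  intro h
  obtain ⟨M, hM⟩ := h (fun t => ![1, Real.exp t, 0]) (isEulerArnold_iff.2 (by
    simp [mulVec_fin_three, hasDerivAt_const, Real.hasDerivAt_exp]))
  have h1 := (norm_le_pi_norm (![1, Real.exp M, 0] : Fin 3 → ℝ) 1).trans (hM M)
  have h2 : Real.exp M ≤ M := by simpa using h1
  linarith [Real.add_one_le_exp M]


/-! ### Incomplete metrics -/

/-- Solutions of the Riccati inequality `f' ≥ f²` with positive initial value blow up. -/
theorem false_of_sq_le_deriv {f f' : ℝ → ℝ} (hf : ∀ t, HasDerivAt f (f' t) t)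
    (hle : ∀ t, f t ^ 2 ≤ f' t) (h0 : 0 < f 0) : False := by
  have hmono : Monotone f := monotone_of_deriv_nonneg (fun t => (hf t).differentiableAt)
    fun t => by rw [(hf t).deriv]; exact (sq_nonneg _).trans (hle t)
  have hpos : ∀ t, 0 ≤ t → 0 < f t := fun t ht => h0.trans_le (hmono ht)
  have hd : ∀ t, 0 ≤ t → HasDerivAt (fun t => (f t)⁻¹ + t) (-f' t / f t ^ 2 + 1) t := fun t ht =>
    ((hf t).fun_inv (hpos t ht).ne').fun_add (hasDerivAt_id t)
  have hanti : AntitoneOn (fun t => (f t)⁻¹ + t) (Set.Ici 0) := by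
    refine antitoneOn_of_deriv_nonpos (convex_Ici 0)
      (fun t ht => (hd t ht).continuousAt.continuousWithinAt)
      (fun t ht => (hd t (interior_subset ht)).differentiableAt.differentiableWithinAt)
      fun t ht => ?_
    have ht' := interior_subset ht
    rw [(hd t ht').deriv, neg_div]
    have : 1 ≤ f' t / f t ^ 2 := (one_le_div (pow_pos (hpos t ht') 2)).2 (hle t)
    linarith
  have hb : 0 ≤ (f 0)⁻¹ := (inv_pos.2 h0).le
  have h1 := hanti (Set.mem_Ici.2 le_rfl) (Set.mem_Ici.2 hb) hb
  have h2 := inv_pos.2 (hpos _ hb)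
  simp only [add_zero] at h1
  linarith

/-- The metrics `α x² + a y² + d z²` for which the plane spanned by `e₁, e₃` is Lorentzian: the
`e₂`-momentum `a y` stays zero if it vanishes initially, so the velocity stays in that plane, and
it blows up if it is null. -/
theorem not_eulerArnoldComplete_diagonal {α a d : ℝ} (ha : a ≠ 0) (hαd : α * d < 0) :
    ¬ EulerArnoldComplete !![α, 0, 0; 0, a, 0; 0, 0, d] := by
  intro h
  have hα : α ≠ 0 := fun h => by simp [h] at hαd
  have hd : d ≠ 0 := fun h => by simp [h] at hαd
  obtain ⟨v, hv, hv0⟩ := h ![1, 0, √(-α / d)]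
  have hdet : (!![α, 0, 0; 0, a, 0; 0, 0, d] : Matrix (Fin 3) (Fin 3) ℝ).det ≠ 0 := by
    simp [Matrix.det_fin_three, hα, hd, ha]
  obtain ⟨T, hT⟩ := hv.exists_momentum hdet
  have hy : ∀ t, v t 1 = 0 := fun t => by
    have := (hT t).1
    simpa [mulVec_fin_three, hv0, ha] using this
  obtain ⟨h0, h1, h2⟩ := isEulerArnold_iff.1 hv
  simp [mulVec_fin_three, hy] at h0 h1 h2
  have hE : ∀ t, d * (d * v t 2) ^ 2 * α + d ^ 2 * (α * v t 0) ^ 2 = 0 := by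
    intro t
    have hder : ∀ t, HasDerivAt
        (fun t => d * (d * v t 2) ^ 2 * α + d ^ 2 * (α * v t 0) ^ 2) 0 t := by
      intro t
      refine (((((h2 t).fun_pow 2).const_mul d).mul_const α).fun_add
        (((h0 t).fun_pow 2).const_mul (d ^ 2))).congr_deriv ?_
      push_cast
      ring
    have := is_const_of_deriv_eq_zero (fun t => (hder t).differentiableAt)
      (fun t => (hder t).deriv) t 0
    refine this.trans ?_
    have hneg : 0 ≤ -α / d := by
      have : -α / d = -(α * d) / d ^ 2 := by field_simp
      rw [this]
      exact div_nonneg (by linarith) (sq_nonneg _)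
    simp only [hv0]
    simp only [Matrix.cons_val_zero, Matrix.cons_val, mul_pow, Real.sq_sqrt hneg]
    field_simp
    ring
  refine false_of_sq_le_deriv (f := fun t => α⁻¹ * (α * v t 0))
    (fun t => (h0 t).const_mul α⁻¹) (fun t => le_of_eq ?_) (by simp [hv0, hα])
  have hz : d * v t 2 ^ 2 = -(α * v t 0 ^ 2) := by
    have : (d ^ 2 * α) * (d * v t 2 ^ 2 + α * v t 0 ^ 2) = 0 := by linear_combination hE t
    have := (mul_eq_zero.1 this).resolve_left (mul_ne_zero (pow_ne_zero 2 hd) hα)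
    linarith
  field_simp
  linear_combination hz

/-- The metrics `α x² + 2 b y z` with `b < 0 < α`: a null geodesic blows up. -/
theorem not_eulerArnoldComplete_of_neg {α b : ℝ} (hα : 0 < α) (hb : b < 0) :
    ¬ EulerArnoldComplete !![α, 0, 0; 0, 0, b; 0, b, 0] := by
  intro h
  obtain ⟨v, hv, hv0⟩ := h ![1, -α / (2 * b), 1]
  obtain ⟨h0, h1, h2⟩ := isEulerArnold_iff.1 hv
  simp [mulVec_fin_three] at h0 h1 h2
  have hE : ∀ t, b * (α * v t 0) ^ 2 + 2 * α * (b * v t 2) * (b * v t 1) = 0 := by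
    intro t
    have hder : ∀ t, HasDerivAt
        (fun t => b * (α * v t 0) ^ 2 + 2 * α * (b * v t 2) * (b * v t 1)) 0 t := by
      intro t
      refine ((((h0 t).fun_pow 2).const_mul b).fun_add
        (((h1 t).const_mul (2 * α)).fun_mul (h2 t))).congr_deriv ?_
      push_cast
      ring
    refine (is_const_of_deriv_eq_zero (fun t => (hder t).differentiableAt)
      (fun t => (hder t).deriv) t 0).trans ?_
    simp only [hv0]
    simp only [Matrix.cons_val_zero, Matrix.cons_val_one, Matrix.cons_val]
    field_simp [hb.ne]
    ring
  refine false_of_sq_le_deriv (f := fun t => α⁻¹ * (α * v t 0))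
    (fun t => (h0 t).const_mul α⁻¹) (fun t => ?_) (by simp [hv0, hα.ne'])
  have hyz : 2 * b * v t 1 * v t 2 = -(α * v t 0 ^ 2) := by
    have : (α * b) * (2 * b * v t 1 * v t 2 + α * v t 0 ^ 2) = 0 := by linear_combination hE t
    have := (mul_eq_zero.1 this).resolve_left (mul_ne_zero hα.ne' hb.ne)
    linarith
  have e : α⁻¹ * (-(v t 1 + v t 2) * (b * v t 2) - v t 2 * (b * v t 1))
      = v t 0 ^ 2 + -b / α * v t 2 ^ 2 := by
    field_simp
    linear_combination -hyz
  rw [inv_mul_cancel_left₀ hα.ne']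
  refine le_of_le_of_eq ?_ (e.symm.trans (by ring))
  have : 0 ≤ -b / α * v t 2 ^ 2 := mul_nonneg (div_nonneg (by linarith) hα.le) (sq_nonneg _)
  linarith

/-- The plane spanned by `e₂, e₃` is degenerate with kernel spanned by `e₂`: the `e₂`-momentum is
proportional to `x`, which therefore solves a Riccati equation. -/
theorem not_eulerArnoldComplete_of_kernel_two {u k l d : ℝ} (hk : k ≠ 0) :
    ¬ EulerArnoldComplete !![u, k, l; k, 0, 0; l, 0, d] := by
  intro h
  obtain ⟨v, hv, hv0⟩ := h ![1, 0, 0]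
  obtain ⟨-, h1, -⟩ := isEulerArnold_iff.1 hv
  simp [mulVec_fin_three] at h1
  refine false_of_sq_le_deriv (f := fun t => k⁻¹ * (k * v t 0))
    (fun t => (h1 t).const_mul k⁻¹) (fun t => le_of_eq ?_) (by simp [hv0, hk])
  field_simp

/-- The plane spanned by `e₂, e₃` is degenerate with kernel spanned by `e₃`: the `e₃`-momentum is
proportional to `x`, which solves a Riccati equation whenever the `e₂`-momentum vanishes. -/
theorem not_eulerArnoldComplete_of_kernel_three {u k l a : ℝ} (ha : a ≠ 0) (hl : l ≠ 0) :
    ¬ EulerArnoldComplete !![u, k, l; k, a, 0; l, 0, 0] := by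
  intro h
  obtain ⟨v, hv, hv0⟩ := h ![1, -k / a, 0]
  have hdet : (!![u, k, l; k, a, 0; l, 0, 0] : Matrix (Fin 3) (Fin 3) ℝ).det ≠ 0 := by
    simp [Matrix.det_fin_three, ha, hl]
  obtain ⟨T, hT⟩ := hv.exists_momentum hdet
  have hm : ∀ t, k * v t 0 + a * v t 1 = 0 := fun t => by
    have h1 := (hT t).1
    simp [mulVec_fin_three, hv0] at h1
    rw [h1]
    field_simp
    ring
  obtain ⟨-, -, h2⟩ := isEulerArnold_iff.1 hv
  simp [mulVec_fin_three, hm] at h2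
  refine false_of_sq_le_deriv (f := fun t => l⁻¹ * (l * v t 0))
    (fun t => (h2 t).const_mul l⁻¹) (fun t => le_of_eq ?_) (by simp [hv0, hl])
  field_simp

/-! ### Classification -/

/-- A left-invariant Lorentzian metric is incomplete, or equivalent to some `Q2 s`, or equivalent
to `Q3`. -/
theorem classification {Q : Matrix (Fin 3) (Fin 3) ℝ} (hQ : Q.IsSymm) (hdet : Q.det < 0)
    (hpos : ∃ w : Fin 3 → ℝ, 0 < w ⬝ᵥ Q *ᵥ w) :
    ¬ EulerArnoldComplete Q ∨
    (∃ s : ℝ, 0 < s ∧ ∃ p q a b c : ℝ, a ≠ 0 ∧ c ≠ 0 ∧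
      (autMat p q a b)ᵀ * !![1, 0, 0; 0, -1, 0; 0, 0, s] * autMat p q a b = c • Q) ∨
    ∃ p q a b c : ℝ, a ≠ 0 ∧ c ≠ 0 ∧
      (autMat p q a b)ᵀ * !![1, 0, 0; 0, 0, 1; 0, 1, 0] * autMat p q a b = c • Q := by
  obtain ⟨w, hw⟩ := hpos
  have h10 : Q 1 0 = Q 0 1 := hQ.apply 0 1
  have h20 : Q 2 0 = Q 0 2 := hQ.apply 0 2
  have h21 : Q 2 1 = Q 1 2 := hQ.apply 1 2
  obtain ⟨A, hA⟩ : ∃ A, A = Q 0 0 := ⟨_, rfl⟩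
  obtain ⟨B, hB⟩ : ∃ B, B = Q 0 1 := ⟨_, rfl⟩
  obtain ⟨C, hC⟩ : ∃ C, C = Q 0 2 := ⟨_, rfl⟩
  obtain ⟨D, hD⟩ : ∃ D, D = Q 1 1 := ⟨_, rfl⟩
  obtain ⟨E, hE⟩ : ∃ E, E = Q 1 2 := ⟨_, rfl⟩
  obtain ⟨F, hF⟩ : ∃ F, F = Q 2 2 := ⟨_, rfl⟩
  have hQ' : Q = !![A, B, C; B, D, E; C, E, F] := by
    ext i j
    fin_cases i <;> fin_cases j <;> simp [hA, hB, hC, hD, hE, hF, h10, h20, h21]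
  clear hA hB hC hD hE hF h10 h20 h21 hQ
  subst hQ'
  simp [Matrix.det_fin_three] at hdet
  simp only [dotProduct, mulVec_fin_three, Fin.sum_univ_three] at hw
  simp at hw
  generalize w 0 = x at hw
  generalize w 1 = y at hw
  generalize w 2 = z at hw
  by_cases hn : D * F - E ^ 2 = 0
  · left
    by_cases hD : D = 0
    · have hE : E = 0 := by rw [hD] at hn; simpa using hn
      rw [hD, hE] at hdet ⊢
      refine not_eulerArnoldComplete_of_kernel_two ?_
      rintro rfl
      simp at hdet
    · -- `e₃ - (E / D) e₂` spans the kernel of the restriction to the plane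
      have hF : F = E ^ 2 / D := by field_simp; linarith
      -- otherwise `e₃ - (E / D) e₂` would be in the kernel of the whole form
      have hl : C - E / D * B ≠ 0 := by
        intro hl
        have hC : C = E / D * B := by linarith
        rw [hF, hC] at hdet
        field_simp at hdet
        ring_nf at hdet
        simp at hdet
      rw [← eulerArnoldComplete_iff (N := !![A, B, C - E / D * B; B, D, 0; C - E / D * B, 0, 0])
        (p := 0) (q := 0) (a := 1) (b := E / D) (c := 1) one_ne_zero one_ne_zero]
      · exact not_eulerArnoldComplete_of_kernel_three hD hl
      · rw [hF, one_smul]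
        ext i j
        fin_cases i <;> fin_cases j <;>
          simp [autMat, Matrix.mul_apply, Fin.sum_univ_three] <;> field_simp
        ring
  · by_cases hD : D = 0
    · -- the form is `α x² + 2 E (y + β z + p x) (z + q x)`
      subst hD
      have hE : E ≠ 0 := by rintro rfl; simp at hn
      obtain ⟨β, rfl⟩ : ∃ β, F = 2 * E * β := ⟨F / (2 * E), by field_simp⟩
      obtain ⟨q, rfl⟩ : ∃ q, B = E * q := ⟨B / E, by field_simp⟩
      obtain ⟨p, rfl⟩ : ∃ p, C = E * (β * q + p) := ⟨C / E - β * q, by field_simp; ring⟩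
      obtain ⟨α, rfl⟩ : ∃ α, A = α + 2 * E * p * q := ⟨A - 2 * E * p * q, by ring⟩
      have hα : 0 < α := by
        have h1 : 0 < α * E ^ 2 := by linarith
        exact pos_of_mul_pos_left h1 (sq_nonneg E)
      rcases lt_or_gt_of_ne hE with hE' | hE'
      · left
        rw [← eulerArnoldComplete_iff (N := !![α, 0, 0; 0, 0, E; 0, E, 0])
          (p := p) (q := q) (a := 1) (b := β) (c := 1) one_ne_zero one_ne_zero]
        · exact not_eulerArnoldComplete_of_neg hα hE'
        · rw [one_smul]
          ext i j
          fin_cases i <;> fin_cases j <;>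
            simp [autMat, Matrix.mul_apply, Fin.sum_univ_three] <;> ring
      · right; right
        have hk : 0 < E / α := div_pos hE' hα
        have hk2 : √(E / α) ^ 2 = E / α := Real.sq_sqrt hk.le
        refine ⟨√(E / α) * p, √(E / α) * q, √(E / α), √(E / α) * β, α⁻¹,
          (Real.sqrt_pos.2 hk).ne', inv_ne_zero hα.ne', ?_⟩
        generalize √(E / α) = k at hk2
        have hEk : E = α * k ^ 2 := by rw [hk2]; field_simp
        rw [hEk]
        ext i j
        fin_cases i <;> fin_cases j <;>
          simp [autMat, Matrix.mul_apply, Fin.sum_univ_three] <;> field_simp <;> ring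
    · -- the form is `α x² + D (y + β z + p x)² + d (z + q x)²`
      obtain ⟨β, rfl⟩ : ∃ β, E = D * β := ⟨E / D, by field_simp⟩
      obtain ⟨d, rfl⟩ : ∃ d, F = D * β ^ 2 + d := ⟨F - D * β ^ 2, by ring⟩
      have hd : d ≠ 0 := by rintro rfl; apply hn; ring
      obtain ⟨p, rfl⟩ : ∃ p, B = D * p := ⟨B / D, by field_simp⟩
      obtain ⟨q, rfl⟩ : ∃ q, C = D * β * p + d * q := ⟨(C - D * β * p) / d, by field_simp; ring⟩
      obtain ⟨α, rfl⟩ : ∃ α, A = α + D * p ^ 2 + d * q ^ 2 := ⟨A - D * p ^ 2 - d * q ^ 2, by ring⟩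
      have hαDd : α * D * d < 0 := by linarith
      have hα : α ≠ 0 := by rintro rfl; simp at hαDd
      rcases lt_or_gt_of_ne (mul_ne_zero hα hd) with hαd | hαd
      · left
        rw [← eulerArnoldComplete_iff (N := !![α, 0, 0; 0, D, 0; 0, 0, d])
          (p := p) (q := q) (a := 1) (b := β) (c := 1) one_ne_zero one_ne_zero]
        · exact not_eulerArnoldComplete_diagonal hD hαd
        · rw [one_smul]
          ext i j
          fin_cases i <;> fin_cases j <;>
            simp [autMat, Matrix.mul_apply, Fin.sum_univ_three] <;>
            first | ring1 | exact Or.inl (by ring1)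
      · right; left
        have hDneg : D < 0 := by
          by_contra hD'
          have := mul_nonneg hαd.le (not_lt.1 hD')
          linarith
        have hw' : 0 < α * x ^ 2 + D * (y + β * z + p * x) ^ 2 + d * (z + q * x) ^ 2 := by
          linarith
        have hα' : 0 < α := by
          by_contra hα'
          have hα'' : α < 0 := lt_of_le_of_ne (not_lt.1 hα') hα
          have hd' : d < 0 := by
            by_contra hd'
            have := mul_nonneg (neg_nonneg.2 hα''.le) (not_lt.1 hd')
            linarith
          have h1 := mul_nonneg (neg_nonneg.2 hα''.le) (sq_nonneg x)
          have h2 := mul_nonneg (neg_nonneg.2 hDneg.le) (sq_nonneg (y + β * z + p * x))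
          have h3 := mul_nonneg (neg_nonneg.2 hd'.le) (sq_nonneg (z + q * x))
          linarith
        have hd' : 0 < d := pos_of_mul_pos_right hαd hα'.le
        have hk : 0 < -D / α := div_pos (neg_pos.2 hDneg) hα'
        have hk2 : √(-D / α) ^ 2 = -D / α := Real.sq_sqrt hk.le
        refine ⟨d / -D, div_pos hd' (neg_pos.2 hDneg), √(-D / α) * p, √(-D / α) * q, √(-D / α),
          √(-D / α) * β, α⁻¹, (Real.sqrt_pos.2 hk).ne', inv_ne_zero hα, ?_⟩
        have hk0 : √(-D / α) ≠ 0 := (Real.sqrt_pos.2 hk).ne'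
        generalize √(-D / α) = k at hk2 hk0
        have hDk : D = -(α * k ^ 2) := by rw [hk2]; field_simp
        rw [hDk]
        ext i j
        fin_cases i <;> fin_cases j <;>
          simp [autMat, Matrix.mul_apply, Fin.sum_univ_three] <;> field_simp

/-- The value at `1` of a left-invariant Lorentzian metric determines it, and satisfies the
hypotheses of `classification`. -/
theorem exists_eq_leftInvariantField {g : TensorField} (hg : IsLorentzian g)
    (hg' : IsLeftInvariant g) : ∃ Q : Matrix (Fin 3) (Fin 3) ℝ, g = leftInvariantField Q ∧
      Q.IsSymm ∧ Q.det < 0 ∧ ∃ w : Fin 3 → ℝ, 0 < w ⬝ᵥ Q *ᵥ w := by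
  refine ⟨g 1, hg'.eq_leftInvariantField, hg.symm 1, ?_, ?_⟩
  · obtain ⟨P, -, h⟩ := hg.signature 1
    have h1 := congrArg Matrix.det h
    rw [Matrix.det_mul, Matrix.det_mul, Matrix.det_transpose, Matrix.det_diagonal,
      Fin.prod_univ_three] at h1
    simp at h1
    by_contra hn
    have := mul_nonneg (mul_self_nonneg P.det) (not_lt.1 hn)
    linarith
  · obtain ⟨P, -, h⟩ := hg.signature 1
    refine ⟨P *ᵥ ![0, 1, 0], ?_⟩
    have h1 : (P *ᵥ ![0, 1, 0]) ⬝ᵥ g 1 *ᵥ (P *ᵥ ![0, 1, 0])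
        = ![0, 1, 0] ⬝ᵥ (Pᵀ * g 1 * P) *ᵥ ![0, 1, 0] := by
      rw [← Matrix.mulVec_mulVec, ← Matrix.mulVec_mulVec, Matrix.dotProduct_mulVec ![0, 1, 0] Pᵀ,
        Matrix.vecMul_transpose]
    rw [h1, h]
    simp [dotProduct, Fin.sum_univ_three, Matrix.mulVec_diagonal]

theorem isSymm_Q2 (s : ℝ) : (!![1, 0, 0; 0, -1, 0; 0, 0, s] : Matrix (Fin 3) (Fin 3) ℝ).IsSymm := by
  ext i j; fin_cases i <;> fin_cases j <;> rfl

theorem isSymm_Q3 : (!![1, 0, 0; 0, 0, 1; 0, 1, 0] : Matrix (Fin 3) (Fin 3) ℝ).IsSymm := by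
  ext i j; fin_cases i <;> fin_cases j <;> rfl

theorem isLorentzian_Q2 {s : ℝ} (hs : 0 < s) : IsLorentzian (Q2 s) := by
  have h1 : √s * √s = s := Real.mul_self_sqrt hs.le
  have h2 : √s ≠ 0 := (Real.sqrt_pos.2 hs).ne'
  refine isLorentzian_leftInvariantField (P := !![0, 1, 0; 1, 0, 0; 0, 0, (√s)⁻¹]) (isSymm_Q2 s)
    ?_ ?_
  · simp [Matrix.det_fin_three, h2]
  · ext i j
    fin_cases i <;> fin_cases j <;> simp [Matrix.mul_apply, Fin.sum_univ_three]
    field_simp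
    linarith

theorem isLorentzian_Q3 : IsLorentzian Q3 := by
  refine isLorentzian_leftInvariantField
    (P := !![0, 1, 0; 1, 0, 1; -1 / 2, 0, 1 / 2]) isSymm_Q3 ?_ ?_
  · rw [isUnit_iff_ne_zero]
    simp [Matrix.det_fin_three]
    norm_num
  · ext i j
    fin_cases i <;> fin_cases j <;> simp [Matrix.mul_apply, Fin.sum_univ_three]
    all_goals norm_num

theorem eq_of_areEquivalent_Q2 {s s' : ℝ} (h : AreEquivalent (Q2 s) (Q2 s')) : s = s' := by
  obtain ⟨p, q, a, b, c, ha, -, h⟩ := areEquivalent_leftInvariantField_iff.1 h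
  have h11 := congrFun (congrFun h 1) 1
  have h12 := congrFun (congrFun h 1) 2
  have h22 := congrFun (congrFun h 2) 2
  simp [autMat, Matrix.mul_apply, Fin.sum_univ_three] at h11 h12 h22
  have hb : b = 0 := h12.resolve_left ha
  rw [hb] at h22
  have : a * a * (s - s') = 0 := by linear_combination h22 - s' * h11
  exact sub_eq_zero.1 ((mul_eq_zero.1 this).resolve_left (mul_ne_zero ha ha))

end Psh

end

theorem theorem1 :
    -- the metrics `Q2 s`, `s > 0`, are complete and their geodesics have bounded velocity
    (∀ s : ℝ, 0 < s → Psh.IsLorentzian (Psh.Q2 s) ∧ Psh.IsLeftInvariant (Psh.Q2 s) ∧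
      Psh.IsComplete (Psh.Q2 s) ∧
      ∀ γ, Psh.IsGeodesic (Psh.Q2 s) γ → Psh.HasBoundedVelocity γ) ∧
    -- they are pairwise inequivalent
    (∀ s s' : ℝ, 0 < s → 0 < s' → Psh.AreEquivalent (Psh.Q2 s) (Psh.Q2 s') → s = s') ∧
    -- and there are no others up to automorphism and scaling
    (∀ g, Psh.IsLorentzian g → Psh.IsLeftInvariant g →
      ((Psh.IsComplete g ∧ ∀ γ, Psh.IsGeodesic g γ → Psh.HasBoundedVelocity γ) ↔
        ∃ s : ℝ, 0 < s ∧ Psh.AreEquivalent (Psh.Q2 s) g)) ∧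
    -- the metric `Q3` is complete and has geodesics of unbounded velocity
    (Psh.IsLorentzian Psh.Q3 ∧ Psh.IsLeftInvariant Psh.Q3 ∧ Psh.IsComplete Psh.Q3 ∧
      ∃ γ, Psh.IsGeodesic Psh.Q3 γ ∧ ¬ Psh.HasBoundedVelocity γ) ∧
    -- and it is the only one up to automorphism and scaling
    (∀ g, Psh.IsLorentzian g → Psh.IsLeftInvariant g →
      ((Psh.IsComplete g ∧ ∃ γ, Psh.IsGeodesic g γ ∧ ¬ Psh.HasBoundedVelocity γ) ↔
        Psh.AreEquivalent Psh.Q3 g)) := by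
  have ex_iff (g : Psh.TensorField) : (∃ γ, Psh.IsGeodesic g γ ∧ ¬ Psh.HasBoundedVelocity γ) ↔
      ¬ ∀ γ, Psh.IsGeodesic g γ → Psh.HasBoundedVelocity γ := by
    push Not
    rfl
  have hdet2 (s : ℝ) (hs : 0 < s) :
      (!![1, 0, 0; 0, -1, 0; 0, 0, s] : Matrix (Fin 3) (Fin 3) ℝ).det ≠ 0 := by
    simp [Matrix.det_fin_three, hs.ne']
  have hdet3 : (!![1, 0, 0; 0, 0, 1; 0, 1, 0] : Matrix (Fin 3) (Fin 3) ℝ).det ≠ 0 := by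
    simp [Matrix.det_fin_three]
  refine ⟨fun s hs => ⟨Psh.isLorentzian_Q2 hs, Psh.isLeftInvariant_leftInvariantField _,
    (Psh.isComplete_iff (Psh.isSymm_Q2 s) (hdet2 s hs)).2 (Psh.eulerArnoldComplete_Q2 hs),
    (Psh.forall_hasBoundedVelocity_iff (Psh.isSymm_Q2 s) (hdet2 s hs)).2
      (Psh.eulerArnoldBounded_Q2 hs)⟩, fun s s' _ _ h => Psh.eq_of_areEquivalent_Q2 h,
    fun g hg hg' => ?_, ⟨Psh.isLorentzian_Q3, Psh.isLeftInvariant_leftInvariantField _,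
    (Psh.isComplete_iff Psh.isSymm_Q3 hdet3).2 Psh.eulerArnoldComplete_Q3, ?_⟩,
    fun g hg hg' => ?_⟩
  · obtain ⟨Q, rfl, hQ, hdet, hpos⟩ := Psh.exists_eq_leftInvariantField hg hg'
    rw [Psh.isComplete_iff hQ hdet.ne, Psh.forall_hasBoundedVelocity_iff hQ hdet.ne]
    constructor
    · rintro ⟨hc, hb⟩
      rcases Psh.classification hQ hdet hpos with h | ⟨s, hs, h⟩ | ⟨p, q, a, b, c, ha, hc', h⟩
      · exact absurd hc h
      · exact ⟨s, hs, Psh.areEquivalent_leftInvariantField_iff.2 h⟩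
      · exact absurd ((Psh.eulerArnoldBounded_iff ha hc' h).2 hb) Psh.not_eulerArnoldBounded_Q3
    · rintro ⟨s, hs, h⟩
      obtain ⟨p, q, a, b, c, ha, hc, h⟩ := Psh.areEquivalent_leftInvariantField_iff.1 h
      exact ⟨(Psh.eulerArnoldComplete_iff ha hc h).1 (Psh.eulerArnoldComplete_Q2 hs),
        (Psh.eulerArnoldBounded_iff ha hc h).1 (Psh.eulerArnoldBounded_Q2 hs)⟩
  · rw [ex_iff, Psh.Q3, Psh.forall_hasBoundedVelocity_iff Psh.isSymm_Q3 hdet3]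
    exact Psh.not_eulerArnoldBounded_Q3
  · obtain ⟨Q, rfl, hQ, hdet, hpos⟩ := Psh.exists_eq_leftInvariantField hg hg'
    rw [ex_iff, Psh.isComplete_iff hQ hdet.ne, Psh.forall_hasBoundedVelocity_iff hQ hdet.ne]
    constructor
    · rintro ⟨hc, hb⟩
      rcases Psh.classification hQ hdet hpos with h | ⟨s, hs, p, q, a, b, c, ha, hc', h⟩ | h
      · exact absurd hc h
      · exact absurd ((Psh.eulerArnoldBounded_iff ha hc' h).1 (Psh.eulerArnoldBounded_Q2 hs)) hb
      · exact Psh.areEquivalent_leftInvariantField_iff.2 h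
    · intro h
      obtain ⟨p, q, a, b, c, ha, hc, h⟩ := Psh.areEquivalent_leftInvariantField_iff.1 h
      exact ⟨(Psh.eulerArnoldComplete_iff ha hc h).1 Psh.eulerArnoldComplete_Q3,
        fun hb => Psh.not_eulerArnoldBounded_Q3 ((Psh.eulerArnoldBounded_iff ha hc h).2 hb)⟩
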